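/- Fix an integer $d\ge 1$ and let $\mathcal X_d=\{\langle k,i\rangle : k\ge 0,\ 1\le i\le d\}$, with levels $\ell_k=\{\langle k,1\rangle,\dots,\langle k,d\rangle\}$. A block lower Hessenberg branching process (block LHBP) $\{\boldsymbol Z_n\}$ is a multitype Galton–Watson process with type set $\mathcal X_d$, started by one individual, in which each individual lives for one generation and an individual of type $j$ has, independently of all the others, an offspring vector $\boldsymbol r\in\mathbb N_0^{\mathcal X_d}$ with distribution $p_j$, where for $j\in\ell_k$ the distribution $p_j$ is carried by the vectors without offspring in levels $>k+1$. For $d=1$ it is called an LHBP (with types $0,1,2,\dots$). Let $G_j(\boldsymbol s)=\sum_{\boldsymbol r}p_j(\boldsymbol r)\prod_{x}s_x^{r_x}$, $S=\{\boldsymbol s\in[0,1]^{\mathcal X_d}:\boldsymbol s=\boldsymbol G(\boldsymbol s)\}$ and $S_k=\{(s_j)_{j\in\ell_k}:\boldsymbol s\in S\}$. Let $q_j$ be the probability, starting from one individual of type $j$, that the whole population eventually dies out, and $\tilde q_j$ the probability that, for every $k$, the types of level at most $k$ eventually disappear for good. The process is irreducible if the directed graph on the types with an edge $i\to j$ whenever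 the mean number of type-$j$ children of a type-$i$ individual is positive has a path between any two types; it is singular if every individual has exactly one child with probability one. The process $\{\boldsymbol Z_n\}$ is locally isomorphic to an LHBP $\{\hat{\boldsymbol Z}_n\}$ with offspring distributions $(\hat p_k)_{k\ge0}$ if for every $k\ge 0$, every $j\in\ell_k$ and every $\boldsymbol u$, \[ \hat p_k(\boldsymbol u)=\sum_{\boldsymbol r\,:\ \sum_{x\in\ell_i}r_x=u_i\ \forall i}p_j(\boldsymbol r). \] Suppose that $\{\boldsymbol Z_n\}$ is locally isomorphic to an irreducible LHBP $\{\hat{\boldsymbol Z}_n\}$. Then: 1. $\boldsymbol q=\min S$, for the componentwise order; 2. if $\{\boldsymbol Z_n\}$ is irreducible, if $\{\hat{\boldsymbol Z}_n\}$ is non-singular or $\tilde{\boldsymbol q}=\boldsymbol 1$, and if $S\neq\{\boldsymbol 1\}$, then $\tilde{\boldsymbol q}=\sup\,(S\setminus\{\boldsymbol 1\})$, the componentwise supremum; 3. for every $k\ge 0$, $q_{\langle k,1\rangle}=\dots=q_{\langle k,d\rangle}$ and $\tilde q_{\langle k,1\rangle}=\dots=\tilde q_{\langle k,d\rangle}$,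 and \[ \bigl(x\,q_{\langle k,1\rangle}+(1-x)\,\tilde q_{\langle k,1\rangle}\bigr)\boldsymbol 1_d\in S_k\qquad\text{for all }x\in[0,1]. \] -/

import Mathlib

open MeasureTheory
open scoped ENNReal

noncomputable section

/-- The type set `{⟨k, i⟩ : k ≥ 0, i a phase}`; levels are the first, phases the second
coordinate (phases are numbered `0, …, d - 1`). -/
abbrev TypeSet (d : ℕ) : Type := ℕ × Fin d

/-- Offspring vectors. An individual of level `k` only has offspring in the finitely many types
of level at most `k + 1`, so every offspring vector is finitely supported. -/
abbrev OffspringVec (d : ℕ) : Type := TypeSet d →₀ ℕ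

instance instMeasurableSpaceOffspringVec (d : ℕ) : MeasurableSpace (OffspringVec d) := ⊤

/-- The offspring distributions of a block lower Hessenberg branching process with `d` phases.
A (single-phase) lower Hessenberg branching process is the case `d = 1`. -/
structure BlockLHBP (d : ℕ) where
  /-- `law j` is the offspring distribution of individuals of type `j`. -/
  law : TypeSet d → PMF (OffspringVec d)
  lowerHessenberg : ∀ j, ∀ r ∈ (law j).support, ∀ x : TypeSet d, j.1 + 1 < x.1 → r x = 0

/-- A virtual individual: the type of the root, and the line of descent, the most recent entry
first; the entry `(i, j)` stands for the child of type `j` with number `i` (from `0` on). -/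
abbrev VirtualIndividual (d : ℕ) : Type := TypeSet d × List (ℕ × TypeSet d)

/-- The type of a virtual individual. -/
def typeOf {d : ℕ} : VirtualIndividual d → TypeSet d
  | (root, []) => root
  | (_, (_, j) :: _) => j

/-- The Ulam–Harris space: an outcome assigns an offspring vector to each virtual individual. -/
abbrev Outcome (d : ℕ) : Type := VirtualIndividual d → OffspringVec d

/-- The individual with the given line of descent appears in the population started by one
individual of type `root`. -/
def Appears {d : ℕ} (ω : Outcome d) (root : TypeSet d) : List (ℕ × TypeSet d) → Prop
  | [] => True
  | (i, j) :: l => Appears ω root l ∧ i < ω (root, l) j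

/-- The number of individuals of type `j` in generation `n`. -/
def population {d : ℕ} (ω : Outcome d) (root : TypeSet d) (n : ℕ) (j : TypeSet d) : ℕ∞ :=
  Set.encard {l : List (ℕ × TypeSet d) |
    l.length = n ∧ Appears ω root l ∧ typeOf (root, l) = j}

/-- The event of eventual extinction in the set of types `A`. -/
def extinctionEvent {d : ℕ} (root : TypeSet d) (A : Set (TypeSet d)) : Set (Outcome d) :=
  {ω | ∃ n : ℕ, ∀ m ≥ n, ∀ j ∈ A, population ω root m j = 0}

namespace BlockLHBP

variable {d : ℕ}

/-- The probability measure on the Ulam–Harris space: the offspring vectors of all virtual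
individuals are independent, that of an individual of type `j` having distribution `law j`. -/
def prob (p : BlockLHBP d) : Measure (Outcome d) :=
  Measure.infinitePi fun v : VirtualIndividual d => (p.law (typeOf v)).toMeasure

/-- The global extinction probability vector `q`. -/
def globalExtinction (p : BlockLHBP d) (j : TypeSet d) : ℝ :=
  p.prob.real (extinctionEvent j Set.univ)

/-- The partial extinction probability vector `q̃`: for every `k`, the types of level at most `k`
eventually disappear. -/
def partialExtinction (p : BlockLHBP d) (j : TypeSet d) : ℝ :=
  p.prob.real (⋂ k : ℕ, extinctionEvent j {x | x.1 ≤ k})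

/-- The progeny generating function. -/
def progenyGF (p : BlockLHBP d) (s : TypeSet d → ℝ) (j : TypeSet d) : ℝ :=
  ∑' r : OffspringVec d, (p.law j r).toReal * r.prod fun x n => s x ^ n

/-- The set `S` of fixed points of the progeny generating function in `[0,1]^𝒳`. -/
def fixedPoints (p : BlockLHBP d) : Set (TypeSet d → ℝ) :=
  {s | (∀ j, s j ∈ Set.Icc (0 : ℝ) 1) ∧ s = p.progenyGF s}

/-- The projection `S_k` of `S` onto level `k`. -/
def levelProjection (p : BlockLHBP d) (k : ℕ) : Set (Fin d → ℝ) :=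
  {u | (∀ i, u i ∈ Set.Icc (0 : ℝ) 1) ∧ ∃ s ∈ p.fixedPoints, ∀ i, s (k, i) = u i}

/-- The mean progeny matrix (its entries may be infinite). -/
def meanProgeny (p : BlockLHBP d) (i j : TypeSet d) : ℝ≥0∞ :=
  ∑' r : OffspringVec d, p.law i r * (r j : ℝ≥0∞)

/-- There is a path between any two vertices of the mean progeny representation graph. -/
def Irreducible (p : BlockLHBP d) : Prop :=
  ∀ i j, Relation.ReflTransGen (fun a b => 0 < p.meanProgeny a b) i j

/-- Each individual has exactly one child with probability one. -/
def Singular (p : BlockLHBP d) : Prop :=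
  ∀ j, ∀ r ∈ (p.law j).support, (r.sum fun _ n => n) = 1

/-- The block process `p` is locally isomorphic to the single-phase process `phat`: summing an
offspring vector of a type of level `k` over the phases of each level gives an offspring
vector distributed as that of type `k` in `phat`. -/
def LocallyIsomorphic (p : BlockLHBP d) (phat : BlockLHBP 1) : Prop :=
  ∀ (k : ℕ) (i : Fin d) (u : OffspringVec 1),
    phat.law (k, 0) u =
      ∑' r : {r : OffspringVec d // ∀ l : ℕ, ∑ a : Fin d, r (l, a) = u (l, 0)}, p.law (k, i) r

end BlockLHBP

end

/-! The analysis rests on a few properties of the progeny generating function `G` on the cube: it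
preserves the cube, is monotone, pointwise continuous, fixes `1`, and is convex along segments
between comparable points. `IsGenOp` collects them; they survive iteration and freezing on a set of
types. Probability enters through the branching property `treeLaw_children`. It shows that the
extinction probability in `A` is the limit of `G^N h`, where `h`, the probability of never visiting
`A`, is itself a limit of iterates of `G` frozen on `A` (`exists_tendsto_extinction`). For `A`
everything, `h = 0`, which gives the minimality of `q`.

Maximality of `q̃` (`Irreducible.le_extinction`): let `v` be the extinction probability in a finite
set `A`, and suppose that a subsolution `s < 1` exceeds `v` somewhere on `A`. Choose the least `t`
with `s ≤ w := (1 - t) v + t` on `A`. As no mass is lost at infinity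
(`exists_tendsto_frozen_extinction`), `s ≤ w` everywhere, with contact at one type. Convexity makes
`w` a supersolution, so irreducibility spreads the contact to all types. Equality in the convexity
inequality then excludes two or more children, and the process is singular. Letting `A` exhaust the
types gives the bound by `q̃`.

Intermediate values (`exists_fixedPoint_apply_eq`): on the levels up to `k`, solve the fixed point
equation with a constant boundary value on the higher levels, tuned so that a given coordinate
equals `x`; then let `k` grow, by compactness.

Local isomorphism makes `G` commute with extending vectors constantly along levels
(`LocallyIsomorphic.progenyGF_lift`). Hence extinction probabilities are constant on levels, and the
intermediate fixed points of the single-phase process extend to the block process. When `q̃ = 1`,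
those fixed points also show that the supremum is `1`. -/

namespace BlockLHBP

open Filter Topology

/-- The monomial `∏ x, s x ^ r x`. -/
def monomial {d : ℕ} (s : TypeSet d → ℝ) (r : OffspringVec d) : ℝ := r.prod fun x n => s x ^ n

/-- The cube `[0,1]^𝒳`. -/
def unitCube (d : ℕ) : Set (TypeSet d → ℝ) := {s | ∀ j, s j ∈ Set.Icc (0 : ℝ) 1}

/-! ### Monomials on the cube: monotonicity, convexity along ordered segments, strictness. -/

section Monomial

variable {d : ℕ} {f g : TypeSet d → ℝ}

@[simp] lemma monomial_zero (f : TypeSet d → ℝ) : monomial f 0 = 1 := by simp [monomial]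

lemma monomial_add (f : TypeSet d → ℝ) (r r' : OffspringVec d) :
    monomial f (r + r') = monomial f r * monomial f r' :=
  Finsupp.prod_add_index' (by simp) (by intro a b c; exact pow_add _ _ _)

@[simp] lemma monomial_single (f : TypeSet d → ℝ) (x : TypeSet d) (n : ℕ) :
    monomial f (Finsupp.single x n) = f x ^ n := by
  simp [monomial]

@[simp] lemma monomial_one (r : OffspringVec d) : monomial 1 r = 1 := by
  simp [monomial, Finsupp.prod]

lemma exists_eq_single_add {r : OffspringVec d} {x : TypeSet d} (h : r x ≠ 0) :
    ∃ r', r = Finsupp.single x 1 + r' :=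
  ⟨r - Finsupp.single x 1, (add_tsub_cancel_of_le (by
    rw [Finsupp.single_le_iff]; omega)).symm⟩

/-- Induction on an offspring vector, one child at a time. -/
lemma offspring_induction {P : OffspringVec d → Prop} (r : OffspringVec d) (h0 : P 0)
    (h1 : ∀ x r, P r → P (Finsupp.single x 1 + r)) : P r := by
  induction r using Finsupp.induction with
  | zero => exact h0
  | single_add x n r _ _ ih =>
    clear * - ih h1
    induction n with
    | zero => simpa using ih
    | succ n ihn =>
      rw [add_comm n 1, Finsupp.single_add, add_assoc]
      exact h1 _ _ ihn

lemma monomial_single_add (f : TypeSet d → ℝ) (x : TypeSet d) (r : OffspringVec d) :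
    monomial f (Finsupp.single x 1 + r) = f x * monomial f r := by
  rw [monomial_add, monomial_single, pow_one]

lemma monomial_mem (hf : f ∈ unitCube d) (r : OffspringVec d) :
    monomial f r ∈ Set.Icc (0 : ℝ) 1 := by
  induction r using offspring_induction with
  | h0 => simp
  | h1 x r ih =>
    rw [monomial_single_add]
    exact ⟨mul_nonneg (hf x).1 ih.1, mul_le_one₀ (hf x).2 ih.1 ih.2⟩

lemma monomial_pos (hf : ∀ x, 0 < f x) (r : OffspringVec d) : 0 < monomial f r :=
  Finset.prod_pos fun x _ => pow_pos (hf x) _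

lemma monomial_mono (hf : f ∈ unitCube d) (hfg : f ≤ g) (r : OffspringVec d) :
    monomial f r ≤ monomial g r :=
  Finset.prod_le_prod (fun x _ => pow_nonneg (hf x).1 _)
    fun x _ => pow_le_pow_left₀ (hf x).1 (hfg x) _

/-- Products of nonnegative, nondecreasing convex functions of `t` are convex. The order `f ≤ g` is
essential: `x * y` is not convex on the square. -/
lemma monomial_segment_le (hf : f ∈ unitCube d) (hg : g ∈ unitCube d) (hfg : f ≤ g) {t : ℝ}
    (ht : t ∈ Set.Icc (0 : ℝ) 1) (r : OffspringVec d) :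
    monomial ((1 - t) • f + t • g) r ≤ (1 - t) * monomial f r + t * monomial g r := by
  induction r using offspring_induction with
  | h0 => simp
  | h1 x r ih =>
    simp only [monomial_single_add]
    have hx : 0 ≤ ((1 - t) • f + t • g) x := by
      simp only [Pi.add_apply, Pi.smul_apply, smul_eq_mul]
      have := mul_nonneg (sub_nonneg.2 ht.2) (hf x).1
      have := mul_nonneg ht.1 (hg x).1
      linarith
    refine (mul_le_mul_of_nonneg_left ih hx).trans ?_
    simp only [Pi.add_apply, Pi.smul_apply, smul_eq_mul]
    -- The gap between chord and product is `t (1 - t) (g x - f x) (monomial g r - monomial f r)`.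
    have h1 := mul_nonneg (mul_nonneg ht.1 (sub_nonneg.2 ht.2))
      (mul_nonneg (sub_nonneg.2 (hfg x)) (sub_nonneg.2 (monomial_mono hf hfg r)))
    nlinarith [h1]

lemma eq_of_monomial_eq (hf : f ∈ unitCube d) (hfg : f ≤ g) (hg : ∀ x, 0 < g x)
    {r : OffspringVec d} (h : monomial f r = monomial g r) {x : TypeSet d} (hx : r x ≠ 0) :
    f x = g x := by
  obtain ⟨r', rfl⟩ := exists_eq_single_add hx
  rw [monomial_single_add, monomial_single_add] at h
  by_contra hne
  have hlt := lt_of_le_of_ne (hfg x) hne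
  have h1 := mul_le_mul_of_nonneg_left (monomial_mono hf hfg r') (hf x).1
  have h2 := mul_lt_mul_of_pos_right hlt (monomial_pos hg r')
  linarith

/-- With two children split off as factors, the gap `t (1 - t) (1 - f x) (1 - monomial f r')` is
positive. -/
lemma monomial_segment_one_lt (hf : f ∈ unitCube d) (hf1 : ∀ x, f x < 1) {t : ℝ}
    (ht0 : 0 < t) (ht1 : t < 1) {r : OffspringVec d} (hr : 1 < r.sum fun _ n => n) :
    monomial ((1 - t) • f + t • 1) r < (1 - t) * monomial f r + t := by
  obtain ⟨x, hx⟩ : ∃ x, r x ≠ 0 := by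
    by_contra! h
    have : r = 0 := Finsupp.ext h
    simp [this] at hr
  obtain ⟨r', rfl⟩ := exists_eq_single_add hx
  obtain ⟨y, hy⟩ : ∃ y, r' y ≠ 0 := by
    by_contra! h
    have : r' = 0 := Finsupp.ext h
    simp [this] at hr
  have hlt : monomial f r' < 1 := by
    obtain ⟨r'', rfl⟩ := exists_eq_single_add hy
    rw [monomial_single_add]
    have := mul_le_mul_of_nonneg_left (monomial_mem hf r'').2 (hf y).1
    linarith [hf1 y]
  have h1 : (1 : TypeSet d → ℝ) ∈ unitCube d := fun j => by simp
  have hle := monomial_segment_le hf h1 (fun x => (hf x).2) ⟨ht0.le, ht1.le⟩ r'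
  rw [monomial_one, mul_one] at hle
  simp only [monomial_single_add]
  have hx0 : 0 ≤ ((1 - t) • f + t • (1 : TypeSet d → ℝ)) x := by
    simp only [Pi.add_apply, Pi.smul_apply, smul_eq_mul, Pi.one_apply, mul_one]
    have := mul_nonneg (sub_nonneg.2 ht1.le) (hf x).1
    linarith
  refine (mul_le_mul_of_nonneg_left hle hx0).trans_lt ?_
  simp only [Pi.add_apply, Pi.smul_apply, smul_eq_mul, Pi.one_apply, mul_one]
  have h1 := mul_pos (mul_pos ht0 (sub_pos.2 ht1)) (mul_pos (sub_pos.2 (hf1 x)) (sub_pos.2 hlt))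
  nlinarith [h1]

end Monomial

lemma one_mem_unitCube {d : ℕ} : (1 : TypeSet d → ℝ) ∈ unitCube d := fun j => by simp

lemma zero_mem_unitCube {d : ℕ} : (0 : TypeSet d → ℝ) ∈ unitCube d := fun j => by simp

lemma segment_mem_unitCube {d : ℕ} {f g : TypeSet d → ℝ} (hf : f ∈ unitCube d)
    (hg : g ∈ unitCube d) {t : ℝ} (ht : t ∈ Set.Icc (0 : ℝ) 1) :
    (1 - t) • f + t • g ∈ unitCube d := fun x =>
  convex_Icc (0 : ℝ) 1 (hf x) (hg x) (sub_nonneg.2 ht.2) ht.1 (by ring)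

/-! ### The progeny generating function as a monotone, convex, continuous operator. -/

section Progeny

variable {d : ℕ} (p : BlockLHBP d) {f g : TypeSet d → ℝ}

lemma hasSum_law (j : TypeSet d) : HasSum (fun r => (p.law j r).toReal) 1 := by
  have h := (p.law j).tsum_coe
  have := ENNReal.hasSum_toReal (f := p.law j) (by rw [h]; simp)
  rwa [← ENNReal.tsum_toReal_eq (fun r => (p.law j).apply_ne_top r), h,
    ENNReal.toReal_one] at this

lemma summable_progenyGF (hf : f ∈ unitCube d) (j : TypeSet d) :
    Summable fun r => (p.law j r).toReal * monomial f r :=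
  Summable.of_nonneg_of_le (fun r => mul_nonneg ENNReal.toReal_nonneg (monomial_mem hf r).1)
    (fun r => mul_le_of_le_one_right ENNReal.toReal_nonneg (monomial_mem hf r).2)
    (p.hasSum_law j).summable

lemma progenyGF_eq (f : TypeSet d → ℝ) (j : TypeSet d) :
    p.progenyGF f j = ∑' r, (p.law j r).toReal * monomial f r := rfl

lemma progenyGF_one : p.progenyGF 1 = 1 := by
  ext j
  simp [progenyGF_eq, (p.hasSum_law j).tsum_eq]

lemma progenyGF_mono (hf : f ∈ unitCube d) (hg : g ∈ unitCube d) (h : f ≤ g) :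
    p.progenyGF f ≤ p.progenyGF g := fun j =>
  (p.summable_progenyGF hf j).tsum_le_tsum
    (fun r => mul_le_mul_of_nonneg_left (monomial_mono hf h r) ENNReal.toReal_nonneg)
    (p.summable_progenyGF hg j)

lemma progenyGF_mem (hf : f ∈ unitCube d) : p.progenyGF f ∈ unitCube d := fun j =>
  ⟨tsum_nonneg fun r => mul_nonneg ENNReal.toReal_nonneg (monomial_mem hf r).1, by
    have := p.progenyGF_mono hf one_mem_unitCube (fun x => (hf x).2) j
    rwa [p.progenyGF_one] at this⟩

/-- If a termwise inequality of bounded functions of the offspring vector integrates to an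
equality, then it is an equality on the support of the offspring law. -/
lemma eq_on_support_of_tsum_eq {j : TypeSet d} {a b : OffspringVec d → ℝ}
    (ha : Summable fun r => (p.law j r).toReal * a r)
    (hb : Summable fun r => (p.law j r).toReal * b r) (hab : ∀ r, a r ≤ b r)
    (h : ∑' r, (p.law j r).toReal * b r ≤ ∑' r, (p.law j r).toReal * a r) :
    ∀ r ∈ (p.law j).support, a r = b r := by
  intro r hr
  have hpos : 0 < (p.law j r).toReal :=
    ENNReal.toReal_pos ((p.law j).mem_support_iff r |>.1 hr) ((p.law j).apply_ne_top r)
  by_contra hne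
  have hlt := mul_lt_mul_of_pos_left (lt_of_le_of_ne (hab r) hne) hpos
  have := Summable.tsum_lt_tsum
    (fun r => mul_le_mul_of_nonneg_left (hab r) (ENNReal.toReal_nonneg (a := p.law j r))) hlt ha hb
  linarith

lemma progenyGF_segment_le (hf : f ∈ unitCube d) (hg : g ∈ unitCube d) (hfg : f ≤ g) {t : ℝ}
    (ht : t ∈ Set.Icc (0 : ℝ) 1) :
    p.progenyGF ((1 - t) • f + t • g) ≤ (1 - t) • p.progenyGF f + t • p.progenyGF g := by
  intro j
  simp only [Pi.add_apply, Pi.smul_apply, smul_eq_mul, progenyGF_eq]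
  rw [← tsum_mul_left, ← tsum_mul_left, ← Summable.tsum_add
    ((p.summable_progenyGF hf j).mul_left _) ((p.summable_progenyGF hg j).mul_left _)]
  refine (p.summable_progenyGF (segment_mem_unitCube hf hg ht) j).tsum_le_tsum (fun r => ?_)
    (((p.summable_progenyGF hf j).mul_left _).add ((p.summable_progenyGF hg j).mul_left _))
  have := mul_le_mul_of_nonneg_left (monomial_segment_le hf hg hfg ht r)
    (ENNReal.toReal_nonneg (a := p.law j r))
  linarith

/-- Dominated convergence, with the offspring law as the bound. The filter is arbitrary because an
ultrafilter limit is taken later. -/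
lemma progenyGF_tendsto {ι : Type*} {l : Filter ι} {F : ι → TypeSet d → ℝ}
    (hF : ∀ i, F i ∈ unitCube d) (h : ∀ x, Tendsto (F · x) l (𝓝 (f x))) (j : TypeSet d) :
    Tendsto (fun i => p.progenyGF (F i) j) l (𝓝 (p.progenyGF f j)) := by
  refine tendsto_tsum_of_dominated_convergence (p.hasSum_law j).summable (fun r => ?_)
    (Eventually.of_forall fun i r => ?_)
  · exact Tendsto.const_mul _ (tendsto_finsetProd _ fun x _ => (h x).pow _)
  · have := monomial_mem (hF i) r
    change ‖_ * monomial (F i) r‖ ≤ _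
    rw [Real.norm_of_nonneg (mul_nonneg ENNReal.toReal_nonneg this.1)]
    exact mul_le_of_le_one_right ENNReal.toReal_nonneg this.2

end Progeny

/-! ### Operators of generating-function type, their iterates and monotone limits. -/

/-- The properties of the progeny generating function that are inherited by the operators derived
from it: it preserves the cube, is monotone, convex along ordered segments, and continuous. -/
structure IsGenOp {d : ℕ} (T : (TypeSet d → ℝ) → TypeSet d → ℝ) : Prop where
  mem : ∀ {f}, f ∈ unitCube d → T f ∈ unitCube d
  mono : ∀ {f g}, f ∈ unitCube d → g ∈ unitCube d → f ≤ g → T f ≤ T g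
  segment_le : ∀ {f g}, f ∈ unitCube d → g ∈ unitCube d → f ≤ g → ∀ {t : ℝ},
    t ∈ Set.Icc (0 : ℝ) 1 → T ((1 - t) • f + t • g) ≤ (1 - t) • T f + t • T g
  tendsto : ∀ {F : ℕ → TypeSet d → ℝ} {f : TypeSet d → ℝ}, (∀ i, F i ∈ unitCube d) →
    (∀ x, Tendsto (F · x) atTop (𝓝 (f x))) → ∀ x, Tendsto (fun n => T (F n) x) atTop (𝓝 (T f x))
  one : T 1 = 1

open Classical in
/-- The operator `T` frozen on the set `A`. -/
noncomputable def frozen {d : ℕ} (A : Set (TypeSet d)) (T : (TypeSet d → ℝ) → TypeSet d → ℝ)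
    (f : TypeSet d → ℝ) : TypeSet d → ℝ := A.piecewise f (T f)

lemma isGenOp_progenyGF {d : ℕ} (p : BlockLHBP d) : IsGenOp p.progenyGF where
  mem := p.progenyGF_mem
  mono := p.progenyGF_mono
  segment_le := p.progenyGF_segment_le
  tendsto := p.progenyGF_tendsto
  one := p.progenyGF_one

namespace IsGenOp

variable {d : ℕ} {T : (TypeSet d → ℝ) → TypeSet d → ℝ} {f g : TypeSet d → ℝ}

lemma frozen (hT : IsGenOp T) (A : Set (TypeSet d)) : IsGenOp (frozen A T) where
  mem hf x := by
    by_cases hx : x ∈ A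
    · simpa [BlockLHBP.frozen, hx] using hf x
    · simpa [BlockLHBP.frozen, hx] using hT.mem hf x
  mono hf hg h x := by
    by_cases hx : x ∈ A
    · simpa [BlockLHBP.frozen, hx] using h x
    · simpa [BlockLHBP.frozen, hx] using hT.mono hf hg h x
  segment_le hf hg h t ht x := by
    by_cases hx : x ∈ A
    · simp [BlockLHBP.frozen, hx]
    · simpa [BlockLHBP.frozen, hx] using hT.segment_le hf hg h ht x
  tendsto hF h x := by
    by_cases hx : x ∈ A
    · simpa [BlockLHBP.frozen, hx] using h x
    · simpa [BlockLHBP.frozen, hx] using hT.tendsto hF h x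
  one := by
    ext x
    by_cases hx : x ∈ A <;> simp [BlockLHBP.frozen, hx, hT.one]

lemma iterate (hT : IsGenOp T) (n : ℕ) : IsGenOp T^[n] := by
  induction n with
  | zero =>
    exact ⟨id, fun _ _ h => h, fun _ _ _ _ _ => le_rfl, fun _ h => h, rfl⟩
  | succ n ih =>
    refine ⟨fun hf => ?_, fun hf hg h => ?_, fun {f g} hf hg h t ht => ?_, fun hF h => ?_, ?_⟩
    · rw [Function.iterate_succ_apply']; exact hT.mem (ih.mem hf)
    · simp only [Function.iterate_succ_apply']
      exact hT.mono (ih.mem hf) (ih.mem hg) (ih.mono hf hg h)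
    · simp only [Function.iterate_succ_apply']
      exact (hT.mono (ih.mem (segment_mem_unitCube hf hg ht))
        (segment_mem_unitCube (ih.mem hf) (ih.mem hg) ht) (ih.segment_le hf hg h ht)).trans
        (hT.segment_le (ih.mem hf) (ih.mem hg) (ih.mono hf hg h) ht)
    · simp only [Function.iterate_succ_apply']
      exact hT.tendsto (fun i => ih.mem (hF i)) (ih.tendsto hF h)
    · rw [Function.iterate_succ_apply', ih.one, hT.one]

lemma iterate_le (hT : IsGenOp T) (hf : f ∈ unitCube d) (h : T f ≤ f) (n : ℕ) : T^[n] f ≤ f := by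
  induction n with
  | zero => exact le_rfl
  | succ n ih =>
    rw [Function.iterate_succ_apply']
    exact (hT.mono ((hT.iterate n).mem hf) hf ih).trans h

lemma le_iterate (hT : IsGenOp T) (hf : f ∈ unitCube d) (h : f ≤ T f) (n : ℕ) : f ≤ T^[n] f := by
  induction n with
  | zero => exact le_rfl
  | succ n ih =>
    rw [Function.iterate_succ_apply']
    exact h.trans (hT.mono hf ((hT.iterate n).mem hf) ih)

lemma mem_of_tendsto {F : ℕ → TypeSet d → ℝ} (hF : ∀ n, F n ∈ unitCube d)
    (h : ∀ x, Tendsto (F · x) atTop (𝓝 (g x))) : g ∈ unitCube d := fun x =>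
  isClosed_Icc.mem_of_tendsto (h x) (Eventually.of_forall fun n => hF n x)

lemma fixed_of_tendsto (hT : IsGenOp T) (hf : f ∈ unitCube d)
    (h : ∀ x, Tendsto (fun n => T^[n] f x) atTop (𝓝 (g x))) : T g = g := by
  ext x
  have h1 := hT.tendsto (fun n => (hT.iterate n).mem hf) h x
  have h2 := (tendsto_add_atTop_iff_nat 1).2 (h x)
  simp only [Function.iterate_succ_apply'] at h2
  exact tendsto_nhds_unique h1 h2

lemma exists_tendsto_of_le (hT : IsGenOp T) (hf : f ∈ unitCube d) (h : T f ≤ f) :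
    ∃ g ∈ unitCube d, T g = g ∧ (∀ x, Tendsto (fun n => T^[n] f x) atTop (𝓝 (g x))) ∧
      ∀ n, g ≤ T^[n] f := by
  have hanti : ∀ x, Antitone fun n => T^[n] f x := fun x => antitone_nat_of_succ_le fun n => by
    rw [Function.iterate_succ_apply]
    exact (hT.iterate n).mono (hT.mem hf) hf h x
  have hb : ∀ x, BddBelow (Set.range fun n => T^[n] f x) := fun x =>
    ⟨0, by rintro _ ⟨n, rfl⟩; exact ((hT.iterate n).mem hf x).1⟩
  have ht : ∀ x, Tendsto (fun n => T^[n] f x) atTop (𝓝 (⨅ n, T^[n] f x)) :=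
    fun x => tendsto_atTop_ciInf (hanti x) (hb x)
  exact ⟨fun x => ⨅ n, T^[n] f x, mem_of_tendsto (fun n => (hT.iterate n).mem hf) ht,
    hT.fixed_of_tendsto hf ht, ht, fun n x => ciInf_le (hb x) n⟩

lemma exists_tendsto_of_ge (hT : IsGenOp T) (hf : f ∈ unitCube d) (h : f ≤ T f) :
    ∃ g ∈ unitCube d, T g = g ∧ (∀ x, Tendsto (fun n => T^[n] f x) atTop (𝓝 (g x))) ∧
      ∀ n, T^[n] f ≤ g := by
  have hmono : ∀ x, Monotone fun n => T^[n] f x := fun x => monotone_nat_of_le_succ fun n => by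
    rw [Function.iterate_succ_apply]
    exact (hT.iterate n).mono hf (hT.mem hf) h x
  have hb : ∀ x, BddAbove (Set.range fun n => T^[n] f x) := fun x =>
    ⟨1, by rintro _ ⟨n, rfl⟩; exact ((hT.iterate n).mem hf x).2⟩
  have ht : ∀ x, Tendsto (fun n => T^[n] f x) atTop (𝓝 (⨆ n, T^[n] f x)) :=
    fun x => tendsto_atTop_ciSup (hmono x) (hb x)
  exact ⟨fun x => ⨆ n, T^[n] f x, mem_of_tendsto (fun n => (hT.iterate n).mem hf) ht,
    hT.fixed_of_tendsto hf ht, ht, fun n x => le_ciSup (hb x) n⟩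

end IsGenOp

/-! ### Family trees and the events of avoiding a set of types. -/

/-- The space of family trees of a single individual: an outcome assigns an offspring vector to
each line of descent. -/
abbrev Tree (d : ℕ) : Type := List (ℕ × TypeSet d) → OffspringVec d

/-- The individual with the given line of descent appears in the family tree. -/
def AppearsIn {d : ℕ} (η : Tree d) : List (ℕ × TypeSet d) → Prop
  | [] => True
  | (i, j) :: l => AppearsIn η l ∧ i < η l j

/-- The family tree of the child `a` of the root. -/
def subtree {d : ℕ} (a : ℕ × TypeSet d) (η : Tree d) : Tree d := fun l => η (l ++ [a])

/-- No individual of a type in `A` appears in the generations `N, …, N + m`. -/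
def avoids {d : ℕ} (A : Set (TypeSet d)) (N m : ℕ) (y : TypeSet d) : Set (Tree d) :=
  {η | ∀ l : List (ℕ × TypeSet d), N ≤ l.length → l.length ≤ N + m → AppearsIn η l →
    typeOf (y, l) ∉ A}

section Tree

variable {d : ℕ}

lemma appears_iff (ω : Outcome d) (root : TypeSet d) (l : List (ℕ × TypeSet d)) :
    Appears ω root l ↔ AppearsIn (fun l => ω (root, l)) l := by
  induction l with
  | nil => rfl
  | cons a l ih => exact and_congr ih Iff.rfl

lemma appearsIn_append (η : Tree d) (l : List (ℕ × TypeSet d)) (a : ℕ × TypeSet d) :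
    AppearsIn η (l ++ [a]) ↔ a.1 < η [] a.2 ∧ AppearsIn (subtree a η) l := by
  induction l with
  | nil => simp [AppearsIn]
  | cons b l ih =>
    change AppearsIn η (l ++ [a]) ∧ _ ↔ _ ∧ (_ ∧ _)
    rw [ih, and_assoc]
    rfl

lemma typeOf_append (y : TypeSet d) (l : List (ℕ × TypeSet d)) (a : ℕ × TypeSet d) :
    typeOf (y, l ++ [a]) = typeOf (a.2, l) := by
  cases l <;> rfl

lemma mem_avoids_succ (A : Set (TypeSet d)) (N m : ℕ) (y : TypeSet d) (η : Tree d) :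
    η ∈ avoids A (N + 1) m y ↔
      ∀ a : ℕ × TypeSet d, a.1 < η [] a.2 → subtree a η ∈ avoids A N m a.2 := by
  constructor
  · intro h a ha l h1 h2 hl
    rw [← typeOf_append y]
    exact h _ (by simpa using h1) (by simp; omega) ((appearsIn_append _ _ _).2 ⟨ha, hl⟩)
  · intro h l h1 h2 hl
    rcases List.eq_nil_or_concat l with rfl | ⟨l, a, rfl⟩
    · simp at h1
    · simp only [List.concat_eq_append, List.length_append, List.length_singleton] at *
      rw [appearsIn_append] at hl
      rw [typeOf_append]
      exact h a hl.1 l (by omega) (by omega) hl.2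

lemma mem_avoids_zero_succ (A : Set (TypeSet d)) (m : ℕ) (y : TypeSet d) (η : Tree d) :
    η ∈ avoids A 0 (m + 1) y ↔ y ∉ A ∧
      ∀ a : ℕ × TypeSet d, a.1 < η [] a.2 → subtree a η ∈ avoids A 0 m a.2 := by
  rw [← mem_avoids_succ A 0 m y]
  constructor
  · intro h
    exact ⟨h [] (by simp) (by simp) trivial, fun l h1 h2 hl => h l (by omega) (by omega) hl⟩
  · rintro ⟨h0, h⟩ l h1 h2 hl
    cases l with
    | nil => exact h0
    | cons a l => exact h _ (by simp) (by omega) hl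

instance instDiscreteMeasurableSpaceOffspringVec : DiscreteMeasurableSpace (OffspringVec d) :=
  ⟨fun _ => MeasurableSpace.measurableSet_top⟩

lemma measurableSet_eval (l : List (ℕ × TypeSet d)) (P : OffspringVec d → Prop) :
    MeasurableSet {η : Tree d | P (η l)} :=
  (measurable_pi_apply l : Measurable fun η : Tree d => η l)
    (MeasurableSet.of_discrete (s := {r | P r}))

lemma measurableSet_appearsIn (l : List (ℕ × TypeSet d)) :
    MeasurableSet {η : Tree d | AppearsIn η l} := by
  induction l with
  | nil => exact MeasurableSet.univ
  | cons a l ih =>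
    exact ih.inter (measurableSet_eval l fun r => a.1 < r a.2)

lemma measurableSet_avoids (A : Set (TypeSet d)) (N m : ℕ) (y : TypeSet d) :
    MeasurableSet (avoids A N m y) := by
  simp only [avoids, Set.ofPred_forall]
  refine MeasurableSet.iInter fun l => MeasurableSet.iInter fun _ => MeasurableSet.iInter fun _ => ?_
  by_cases h : typeOf (y, l) ∈ A
  · simp only [h, not_true_eq_false]
    exact (measurableSet_appearsIn l).compl
  · simp [h]

lemma measurable_subtree (a : ℕ × TypeSet d) : Measurable (subtree (d := d) a) :=
  measurable_pi_lambda _ fun _ => measurable_pi_apply _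

lemma measurableSet_children (E : TypeSet d → Set (Tree d)) (hE : ∀ y, MeasurableSet (E y)) :
    MeasurableSet {η : Tree d | ∀ a : ℕ × TypeSet d, a.1 < η [] a.2 → subtree a η ∈ E a.2} := by
  simp only [Set.ofPred_forall]
  refine MeasurableSet.iInter fun a => ?_
  have h1 : MeasurableSet {η : Tree d | a.1 < η [] a.2} :=
    measurableSet_eval [] fun r => a.1 < r a.2
  have : {η : Tree d | a.1 < η [] a.2 → subtree a η ∈ E a.2} =
      {η : Tree d | a.1 < η [] a.2}ᶜ ∪ subtree a ⁻¹' E a.2 := by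
    ext η; simp [imp_iff_not_or]
  exact this ▸ h1.compl.union (measurable_subtree a (hE a.2))

end Tree

/-! ### The law of a family tree and the branching property. -/

section Measure

variable {d : ℕ} (p : BlockLHBP d)

/-- The law of the family tree of an individual of type `y`. -/
noncomputable def treeLaw (y : TypeSet d) : Measure (Tree d) :=
  Measure.infinitePi fun l : List (ℕ × TypeSet d) => (p.law (typeOf (y, l))).toMeasure

instance (y : TypeSet d) : IsProbabilityMeasure (p.treeLaw y) := by
  unfold treeLaw; infer_instance

lemma map_prob (y : TypeSet d) : p.prob.map (fun ω l => ω (y, l)) = p.treeLaw y :=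
  Measure.map_infinitePi_infinitePi_of_inj
    (P := fun v : VirtualIndividual d => (p.law (typeOf v)).toMeasure)
    (f := fun l : List (ℕ × TypeSet d) => ((y, l) : VirtualIndividual d))
    (fun _ _ h => (Prod.ext_iff.1 h).2)

/-- The family trees of all virtual children of an individual of type `y`; the index `none` carries
the offspring vector of the individual itself. -/
noncomputable def childrenLaw (y : TypeSet d) (o : Option (ℕ × TypeSet d)) : Measure (Tree d) :=
  Measure.infinitePi fun l : List (ℕ × TypeSet d) => (p.law (typeOf (y, l ++ o.toList))).toMeasure

instance (y : TypeSet d) (o : Option (ℕ × TypeSet d)) :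
    IsProbabilityMeasure (p.childrenLaw y o) := by
  unfold childrenLaw; infer_instance

lemma childrenLaw_some (y : TypeSet d) (a : ℕ × TypeSet d) :
    p.childrenLaw y (some a) = p.treeLaw a.2 := by
  simp only [childrenLaw, treeLaw, Option.toList_some, typeOf_append]

lemma childrenLaw_none_apply (y : TypeSet d) (r : OffspringVec d) :
    p.childrenLaw y none {η | η [] = r} = p.law y r := by
  have h := Measure.infinitePi_map_eval
    (fun l : List (ℕ × TypeSet d) => (p.law (typeOf (y, l ++ none.toList))).toMeasure) []
  have h2 : p.childrenLaw y none {η | η [] = r} =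
      (p.childrenLaw y none).map (fun η => η []) {r} := by
    have hm : Measurable fun η : Tree d => η [] := measurable_pi_apply _
    exact (Measure.map_apply hm (measurableSet_singleton r)).symm
  rw [h2]
  unfold childrenLaw
  rw [h, PMF.toMeasure_apply_singleton _ _ (measurableSet_singleton r)]
  rfl

/-- The oldest entry of a line of descent, its last one, names the child of the root through which
the line passes. Cutting it off embeds the lines of descent into pairs (child or `none`, line below
it), so the tree is an injective reindexing of independent coordinates. -/
lemma map_childrenLaw (y : TypeSet d) :
    (Measure.infinitePi (p.childrenLaw y)).map (fun ω l => ω l.getLast? l.dropLast) =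
      p.treeLaw y := by
  have hinj : Function.Injective
      fun l : List (ℕ × TypeSet d) => (l.getLast?, l.dropLast) := by
    intro l l' h
    obtain ⟨h1, h2⟩ := Prod.ext_iff.1 h
    have h1 : l.getLast? = l'.getLast? := h1
    have h2 : l.dropLast = l'.dropLast := h2
    rcases List.eq_nil_or_concat l with rfl | ⟨l, a, rfl⟩ <;>
      rcases List.eq_nil_or_concat l' with rfl | ⟨l', a', rfl⟩ <;> simp_all
  have h1 := Measure.map_infinitePi_infinitePi_of_inj
    (P := fun v : Option (ℕ × TypeSet d) × List (ℕ × TypeSet d) =>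
      (p.law (typeOf (y, v.2 ++ v.1.toList))).toMeasure) hinj
  have h2 := Measure.infinitePi_map_curry_symm
    (fun (o : Option (ℕ × TypeSet d)) (l : List (ℕ × TypeSet d)) =>
      (p.law (typeOf (y, l ++ o.toList))).toMeasure)
  rw [← h2, Measure.map_map (by fun_prop) (by fun_prop)] at h1
  refine Eq.trans h1 ?_
  unfold treeLaw
  congr! 3 with l
  rcases List.eq_nil_or_concat l with rfl | ⟨l, a, rfl⟩ <;> simp

/-- The branching property: the root has offspring distribution `p.law y`, and the family trees of
its children are independent. -/
lemma treeLaw_children (E : TypeSet d → Set (Tree d)) (hE : ∀ y, MeasurableSet (E y))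
    (y : TypeSet d) :
    (p.treeLaw y).real {η | ∀ a : ℕ × TypeSet d, a.1 < η [] a.2 → subtree a η ∈ E a.2} =
      p.progenyGF (fun x => (p.treeLaw x).real (E x)) y := by
  classical
  set C : Set (Tree d) := {η | ∀ a : ℕ × TypeSet d, a.1 < η [] a.2 → subtree a η ∈ E a.2}
  have hC : MeasurableSet C := measurableSet_children E hE
  have hpiece : ∀ r : OffspringVec d, (p.treeLaw y) (C ∩ {η | η [] = r}) =
      p.law y r * ∏ x ∈ r.support, p.treeLaw x (E x) ^ r x := by
    intro r
    let S : Finset (ℕ × TypeSet d) := (r.support.sigma fun x => Finset.range (r x)).map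
      ⟨fun z => (z.2, z.1), fun z w h => by
        obtain ⟨z1, z2⟩ := z; obtain ⟨w1, w2⟩ := w; simp_all⟩
    have hS : ∀ a : ℕ × TypeSet d, a ∈ S ↔ a.1 < r a.2 := by
      rintro ⟨i, x⟩
      simp only [S, Finset.mem_map, Finset.mem_sigma, Finset.mem_range, Finsupp.mem_support_iff]
      constructor
      · rintro ⟨⟨x', i'⟩, h, h'⟩
        obtain ⟨rfl, rfl⟩ := Prod.mk.inj h'
        exact h.2
      · intro h
        exact ⟨⟨x, i⟩, ⟨by dsimp at h ⊢; omega, h⟩, rfl⟩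
    let t : Option (ℕ × TypeSet d) → Set (Tree d) := fun o => o.elim {η | η [] = r} fun a => E a.2
    have ht : ∀ o, MeasurableSet (t o) := by
      rintro (_ | a)
      · exact measurableSet_eval [] (· = r)
      · exact hE a.2
    rw [← p.map_childrenLaw y, Measure.map_apply (by fun_prop)
      (hC.inter (measurableSet_eval [] (· = r)))]
    -- Once the offspring vector is fixed, the event constrains only finitely many independent
    -- trees, so its probability is a product.
    have hset : (fun (ω : Option (ℕ × TypeSet d) → Tree d) (l : List (ℕ × TypeSet d)) =>
        ω l.getLast? l.dropLast) ⁻¹' (C ∩ {η | η [] = r}) =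
        Set.pi (Finset.insertNone S : Finset (Option (ℕ × TypeSet d))) t := by
      ext ω
      have hsub : ∀ a : ℕ × TypeSet d,
          subtree a (fun l => ω l.getLast? l.dropLast) = ω (some a) := fun a => by
        ext1 l
        simp [subtree]
      simp only [C, Set.mem_preimage, Set.mem_inter_iff, Set.mem_ofPred_eq, hsub, Set.mem_pi,
        Finset.mem_coe, Finset.forall_mem_insertNone, List.getLast?_nil, List.dropLast_nil,
        hS, t, Option.elim]
      constructor
      · rintro ⟨h1, h2⟩
        exact ⟨h2, fun a ha => h1 a (h2 ▸ ha)⟩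
      · rintro ⟨h1, h2⟩
        exact ⟨fun a ha => h2 a (h1 ▸ ha), h1⟩
    rw [hset, Measure.infinitePi_pi _ (fun i _ => ht i), Finset.prod_insertNone]
    congr 1
    · exact p.childrenLaw_none_apply y r
    · simp only [childrenLaw_some, t, Option.elim, S, Finset.prod_map, Finset.prod_sigma]
      exact Finset.prod_congr rfl fun x _ => by
        change ∏ _ ∈ Finset.range (r x), p.treeLaw x (E x) = _
        rw [Finset.prod_const, Finset.card_range]
  have hsum : (p.treeLaw y) C = ∑' r : OffspringVec d,
      p.law y r * ∏ x ∈ r.support, p.treeLaw x (E x) ^ r x := by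
    simp only [← hpiece]
    rw [← measure_iUnion]
    · congr 1
      ext η
      simp
    · intro r r' hr
      refine Set.disjoint_left.2 fun η h h' => hr ?_
      have h1 : η [] = r := h.2
      have h2 : η [] = r' := h'.2
      rw [← h1, h2]
    · exact fun r => hC.inter (measurableSet_eval [] (· = r))
  rw [measureReal_def, hsum, ENNReal.tsum_toReal_eq, progenyGF_eq]
  · refine tsum_congr fun r => ?_
    rw [ENNReal.toReal_mul, ENNReal.toReal_prod]
    simp only [ENNReal.toReal_pow]
    rfl
  · intro r
    exact ENNReal.mul_ne_top ((p.law y).apply_ne_top r)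
      (ENNReal.prod_ne_top fun x _ => ENNReal.pow_ne_top (measure_ne_top _ _))

-- Split at the root: a root in `A` has probability `0` at every stage, which freezing preserves,
-- and a root outside `A` applies `G` to its children.
open Classical in
lemma treeLaw_avoids_zero (A : Set (TypeSet d)) (m : ℕ) :
    (fun y => (p.treeLaw y).real (avoids A 0 m y)) =
      (frozen A p.progenyGF)^[m] (A.piecewise 0 1) := by
  induction m with
  | zero =>
    ext y
    by_cases hy : y ∈ A
    · have : avoids A 0 0 y = ∅ := by
        ext η
        simp [avoids, typeOf, AppearsIn, hy]
      simp [this, hy]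
    · have : avoids A 0 0 y = Set.univ := by
        ext η
        simp [avoids, typeOf, hy]
      simp [this, hy]
  | succ m ih =>
    ext y
    rw [Function.iterate_succ_apply', ← ih]
    by_cases hy : y ∈ A
    · have h1 : ∀ m, avoids A 0 m y = ∅ := fun m => by
        ext η
        simp only [avoids, Set.mem_ofPred_eq, Set.mem_empty_iff_false, iff_false]
        exact fun h => h [] (by simp) (by simp) trivial hy
      simp [frozen, hy, h1]
    · have : avoids A 0 (m + 1) y = {η : Tree d | ∀ a : ℕ × TypeSet d, a.1 < η [] a.2 →
          subtree a η ∈ avoids A 0 m a.2} := by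
        ext η
        rw [mem_avoids_zero_succ]
        simp [hy]
      rw [this, p.treeLaw_children _ (fun y => measurableSet_avoids A 0 m y)]
      simp [frozen, hy]

-- During the first `N` generations nothing is required, so each of them contributes an unfrozen
-- `G`.
open Classical in
lemma treeLaw_avoids (A : Set (TypeSet d)) (N m : ℕ) :
    (fun y => (p.treeLaw y).real (avoids A N m y)) =
      p.progenyGF^[N] ((frozen A p.progenyGF)^[m] (A.piecewise 0 1)) := by
  induction N with
  | zero => exact p.treeLaw_avoids_zero A m
  | succ N ih =>
    ext y
    rw [Function.iterate_succ_apply', ← ih,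
      ← p.treeLaw_children _ (fun y => measurableSet_avoids A N m y)]
    congr 1
    ext η
    exact mem_avoids_succ A N m y η

/-! ### Extinction probabilities as limits of iterates and as fixed points. -/

/-- The probability of eventual extinction in `A`. -/
noncomputable def extinction (A : Set (TypeSet d)) (y : TypeSet d) : ℝ :=
  p.prob.real (extinctionEvent y A)

lemma extinctionEvent_eq (A : Set (TypeSet d)) (y : TypeSet d) :
    extinctionEvent y A = (fun ω l => ω (y, l)) ⁻¹' ⋃ N, ⋂ m, avoids A N m y := by
  ext ω
  simp only [extinctionEvent, population, Set.mem_ofPred_eq, Set.mem_preimage, Set.mem_iUnion,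
    Set.mem_iInter, Set.encard_eq_zero, Set.eq_empty_iff_forall_notMem, avoids, appears_iff]
  refine exists_congr fun N => ⟨fun h m l h1 _ hl hA => ?_, fun h m hm j hj l hl => ?_⟩
  · exact h l.length h1 _ hA l ⟨rfl, hl, rfl⟩
  · obtain ⟨rfl, h2, rfl⟩ := hl
    exact h (l.length - N) l hm (by omega) h2 hj

lemma measurableSet_eventually_avoids (A : Set (TypeSet d)) (y : TypeSet d) :
    MeasurableSet (⋃ N, ⋂ m, avoids A N m y) :=
  MeasurableSet.iUnion fun N => MeasurableSet.iInter fun m => measurableSet_avoids A N m y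

instance : IsProbabilityMeasure p.prob := by
  unfold prob; infer_instance

lemma measurable_tree (y : TypeSet d) :
    Measurable fun (ω : Outcome d) (l : List (ℕ × TypeSet d)) => ω (y, l) :=
  measurable_pi_lambda _ fun _ => measurable_pi_apply _

lemma measurableSet_extinctionEvent (A : Set (TypeSet d)) (y : TypeSet d) :
    MeasurableSet (extinctionEvent y A) := by
  rw [extinctionEvent_eq]
  exact measurable_tree y (measurableSet_eventually_avoids A y)

lemma extinction_eq (A : Set (TypeSet d)) (y : TypeSet d) :
    p.extinction A y = (p.treeLaw y).real (⋃ N, ⋂ m, avoids A N m y) := by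
  rw [extinction, extinctionEvent_eq, ← map_prob, map_measureReal_apply (measurable_tree y)
    (measurableSet_eventually_avoids A y)]

lemma isGenOp_frozen (A : Set (TypeSet d)) : IsGenOp (frozen A p.progenyGF) :=
  p.isGenOp_progenyGF.frozen A

open Classical in
/-- The extinction probability in `A` is obtained by iterating the progeny generating function from
the probabilities of never visiting `A`. -/
lemma exists_tendsto_extinction (A : Set (TypeSet d)) :
    ∃ h ∈ unitCube d,
      (∀ y, Tendsto (fun m => (frozen A p.progenyGF)^[m] (A.piecewise 0 1) y) atTop (𝓝 (h y))) ∧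
      ∀ y, Tendsto (fun N => p.progenyGF^[N] h y) atTop (𝓝 (p.extinction A y)) := by
  have hA : A.piecewise (0 : TypeSet d → ℝ) 1 ∈ unitCube d := fun x => by
    by_cases hx : x ∈ A <;> simp [hx]
  have hlim : ∀ N y, Tendsto (fun m => (p.treeLaw y).real (avoids A N m y)) atTop
      (𝓝 ((p.treeLaw y).real (⋂ m, avoids A N m y))) := fun N y => by
    refine (ENNReal.tendsto_toReal (measure_ne_top _ _)).comp (tendsto_measure_iInter_atTop
      (fun m => (measurableSet_avoids A N m y).nullMeasurableSet) ?_ ⟨0, measure_ne_top _ _⟩)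
    intro m m' hm η hη l h1 h2
    exact hη l h1 (by omega)
  have h0 : ∀ y, Tendsto (fun m => (frozen A p.progenyGF)^[m] (A.piecewise 0 1) y) atTop
      (𝓝 ((p.treeLaw y).real (⋂ m, avoids A 0 m y))) := fun y => by
    have := hlim 0 y
    exact this.congr fun m => congrFun (p.treeLaw_avoids_zero A m) y
  refine ⟨_, IsGenOp.mem_of_tendsto (fun m => ((p.isGenOp_frozen A).iterate m).mem hA) h0, h0,
    fun y => ?_⟩
  have hN : ∀ N, p.progenyGF^[N] (fun y => (p.treeLaw y).real (⋂ m, avoids A 0 m y)) y =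
      (p.treeLaw y).real (⋂ m, avoids A N m y) := fun N => by
    refine tendsto_nhds_unique ((p.isGenOp_progenyGF.iterate N).tendsto
      (fun m => ((p.isGenOp_frozen A).iterate m).mem hA) h0 y) ?_
    exact (hlim N y).congr fun m => congrFun (p.treeLaw_avoids A N m) y
  simp only [hN, extinction_eq]
  refine (ENNReal.tendsto_toReal (measure_ne_top _ _)).comp (tendsto_measure_iUnion_atTop ?_)
  intro N N' hN η hη
  simp only [Set.mem_iInter] at hη ⊢
  intro m l h1 h2
  -- The window starting at `N` is lengthened so that it also ends at generation `N' + m`.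
  exact hη (N' + m - N) l (by omega) (by omega)

lemma extinction_anti {A B : Set (TypeSet d)} (h : A ⊆ B) : p.extinction B ≤ p.extinction A :=
  fun _ => measureReal_mono fun _ ⟨n, hn⟩ => ⟨n, fun m hm j hj => hn m hm j (h hj)⟩

/-- The set of types of level at most `k`. -/
def lowLevels (d k : ℕ) : Set (TypeSet d) := {x | x.1 ≤ k}

lemma tendsto_partialExtinction (y : TypeSet d) :
    Tendsto (fun k => p.extinction (lowLevels d k) y) atTop (𝓝 (p.partialExtinction y)) := by
  refine (ENNReal.tendsto_toReal (measure_ne_top _ _)).comp (tendsto_measure_iInter_atTop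
      (fun m => (measurableSet_extinctionEvent _ y).nullMeasurableSet) ?_ ⟨0, measure_ne_top _ _⟩)
  intro k k' hk ω ⟨n, hn⟩
  exact ⟨n, fun m hm j hj => hn m hm j (le_trans hj hk)⟩

lemma partialExtinction_le (k : ℕ) : p.partialExtinction ≤ p.extinction (lowLevels d k) :=
  fun _ => measureReal_mono (Set.iInter_subset _ k)

lemma extinction_mem (A : Set (TypeSet d)) : p.extinction A ∈ unitCube d := fun _ =>
  ⟨measureReal_nonneg, measureReal_le_one⟩

lemma progenyGF_extinction (A : Set (TypeSet d)) :
    p.progenyGF (p.extinction A) = p.extinction A := by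
  obtain ⟨h, hh, -, h2⟩ := p.exists_tendsto_extinction A
  exact p.isGenOp_progenyGF.fixed_of_tendsto hh h2

lemma partialExtinction_mem : p.partialExtinction ∈ unitCube d := fun _ =>
  ⟨measureReal_nonneg, measureReal_le_one⟩

lemma progenyGF_partialExtinction : p.progenyGF p.partialExtinction = p.partialExtinction := by
  ext y
  refine tendsto_nhds_unique (p.progenyGF_tendsto (fun k => p.extinction_mem (lowLevels d k))
    p.tendsto_partialExtinction y) ?_
  simp only [progenyGF_extinction]
  exact p.tendsto_partialExtinction y

lemma globalExtinction_le_partialExtinction : p.globalExtinction ≤ p.partialExtinction := by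
  intro y
  refine ge_of_tendsto (p.tendsto_partialExtinction y) (Eventually.of_forall fun k => ?_)
  exact p.extinction_anti (Set.subset_univ _) y

end Measure

lemma frozen_iterate_apply {d : ℕ} {A : Set (TypeSet d)} (T : (TypeSet d → ℝ) → TypeSet d → ℝ)
    (f : TypeSet d → ℝ) (n : ℕ) {x : TypeSet d} (hx : x ∈ A) : (frozen A T)^[n] f x = f x := by
  classical
  induction n with
  | zero => rfl
  | succ n ih => rw [Function.iterate_succ_apply', frozen, Set.piecewise_eq_of_mem _ _ _ hx, ih]

/-! ### Maximality of extinction probabilities in finite sets of types. -/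

section Maximality

variable {d : ℕ} (p : BlockLHBP d)

lemma exists_offspring_of_meanProgeny_pos {i j : TypeSet d} (h : 0 < p.meanProgeny i j) :
    ∃ r ∈ (p.law i).support, r j ≠ 0 := by
  by_contra! hr
  refine h.ne' (ENNReal.tsum_eq_zero.2 fun r => ?_)
  by_cases hs : r ∈ (p.law i).support
  · simp [hr r hs]
  · rw [PMF.mem_support_iff, not_not] at hs
    simp [hs]

/-- A set of types that contains all possible children of its members is empty or everything. -/
lemma Irreducible.forall_of_exists {p : BlockLHBP d} (hp : p.Irreducible) {P : TypeSet d → Prop}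
    (h : ∀ j, P j → ∀ r ∈ (p.law j).support, ∀ x, r x ≠ 0 → P x) {j : TypeSet d} (hj : P j)
    (x : TypeSet d) : P x := by
  induction hp j x with
  | refl => exact hj
  | tail _ hxy ih =>
    obtain ⟨r, hr, hx⟩ := p.exists_offspring_of_meanProgeny_pos hxy
    exact h _ ih r hr _ hx

/-- Strong maximum principle: a value `1` at one type forces the value `1` at all its possible
children. -/
lemma Irreducible.lt_one {p : BlockLHBP d} (hp : p.Irreducible) {s : TypeSet d → ℝ}
    (hs : s ∈ unitCube d) (hfix : p.progenyGF s = s) (hne : s ≠ 1) (j : TypeSet d) : s j < 1 := by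
  by_contra! hj
  refine hne (funext fun x => hp.forall_of_exists (P := fun x => s x = 1) ?_
    (le_antisymm (hs j).2 hj) x)
  intro j hj r hr x hx
  have h := p.eq_on_support_of_tsum_eq (p.summable_progenyGF hs j)
    (p.summable_progenyGF one_mem_unitCube j) (monomial_mono hs fun x => (hs x).2)
    (by rw [← progenyGF_eq, ← progenyGF_eq, p.progenyGF_one, hfix, hj]; rfl) r hr
  exact eq_of_monomial_eq hs (fun x => (hs x).2) (fun _ => one_pos) h hx

open Classical in
/-- Freezing the process at its first visits to `A`, with weight `p.extinction A` for each frozen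
individual, does not lose any mass at infinity. -/
lemma exists_tendsto_frozen_extinction {A : Set (TypeSet d)} {c : ℝ} (hc0 : 0 ≤ c) (hc : c < 1)
    (hA : ∀ x ∈ A, p.extinction A x ≤ c) :
    ∃ u, (∀ x, Tendsto (fun n => (frozen A p.progenyGF)^[n] (A.piecewise (p.extinction A) 1) x)
      atTop (𝓝 (u x))) ∧ u ≤ p.extinction A := by
  have hTA : ∀ f x, x ∈ A → frozen A p.progenyGF f x = f x := fun f x hx => by simp [frozen, hx]
  have hTn : ∀ n f x, x ∈ A → (frozen A p.progenyGF)^[n] f x = f x := fun n f x hx =>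
    frozen_iterate_apply _ f n hx
  have hT := p.isGenOp_frozen A
  obtain ⟨h, hh, h1, h2⟩ := p.exists_tendsto_extinction A
  have hvm := p.extinction_mem A
  have hv := p.progenyGF_extinction A
  set T := frozen A p.progenyGF with hTdef
  set v := p.extinction A
  have hcI : c ∈ Set.Icc (0 : ℝ) 1 := ⟨hc0, hc.le⟩
  have hpw : ∀ {f g}, f ∈ unitCube d → g ∈ unitCube d → A.piecewise f g ∈ unitCube d :=
    fun {f g} hf hg x => by
      by_cases hx : x ∈ A
      · simpa [hx] using hf x
      · simpa [hx] using hg x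
  have hTv : T v = v := by
    ext x
    by_cases hx : x ∈ A
    · exact hTA v x hx
    · simp [hTdef, frozen, hx, hv]
  have hhA : ∀ x ∈ A, h x = 0 := fun x hx => by
    refine tendsto_nhds_unique (h1 x) ?_
    simp only [hTn _ _ x hx, Set.piecewise_eq_of_mem _ _ _ hx]
    exact tendsto_const_nhds
  have h0m : A.piecewise (0 : TypeSet d → ℝ) 1 ∈ unitCube d :=
    hpw zero_mem_unitCube one_mem_unitCube
  have hTh : T h = h := hT.fixed_of_tendsto h0m h1
  have hhG : h ≤ p.progenyGF h := fun x => by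
    by_cases hx : x ∈ A
    · rw [hhA x hx]; exact (p.progenyGF_mem hh x).1
    · conv_lhs => rw [← hTh]
      simp [hTdef, frozen, hx]
  have hhv : h ≤ v := fun x => ge_of_tendsto (h2 x)
    (Eventually.of_forall fun N => p.isGenOp_progenyGF.le_iterate hh hhG N x)
  have hb1 : A.piecewise v 1 ∈ unitCube d := hpw hvm one_mem_unitCube
  have hbh : A.piecewise v h ∈ unitCube d := hpw hvm hh
  have hTb1 : T (A.piecewise v 1) ≤ A.piecewise v 1 := fun x => by
    by_cases hx : x ∈ A
    · rw [hTA _ x hx]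
    · simpa [hx] using (hT.mem hb1 x).2
  obtain ⟨u, hum, hTu, hu, hule⟩ := hT.exists_tendsto_of_le hb1 hTb1
  refine ⟨u, hu, ?_⟩
  have huA : ∀ x ∈ A, u x = v x := fun x hx => by
    refine tendsto_nhds_unique (hu x) ?_
    simp only [hTn _ _ x hx, Set.piecewise_eq_of_mem _ _ _ hx]
    exact tendsto_const_nhds
  have hlow : ∀ n, T^[n] (A.piecewise v h) ≤ v := fun n => by
    have hle : A.piecewise v h ≤ v := fun x => by
      by_cases hx : x ∈ A
      · simp [hx]
      · simpa [hx] using hhv x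
    refine ((hT.iterate n).mono hbh hvm hle).trans ?_
    exact hT.iterate_le hvm hTv.le n
  have h0le : A.piecewise (0 : TypeSet d → ℝ) 1 ≤ 1 := fun x => (h0m x).2
  -- Bound the weights on `A` by `c` and use convexity between the weights `0` and `1` there.
  have hubound : ∀ x, u x ≤ (1 - c) * h x + c := fun x => by
    refine ge_of_tendsto' (((h1 x).const_mul (1 - c)).add_const c) fun n => ?_
    have hseg : A.piecewise v 1 ≤ (1 - c) • A.piecewise (0 : TypeSet d → ℝ) 1 + c • 1 := fun x => by
      by_cases hx : x ∈ A
      · simpa [hx] using hA x hx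
      · simp [hx]
    have := (hule n x).trans (((hT.iterate n).mono hb1 (segment_mem_unitCube h0m one_mem_unitCube
      hcI) hseg x).trans ((hT.iterate n).segment_le h0m one_mem_unitCube h0le hcI x))
    simpa [(hT.iterate n).one] using this
  have huseg : u ≤ (1 - c) • A.piecewise v h + c • A.piecewise v 1 := fun x => by
    by_cases hx : x ∈ A
    · simp only [Pi.add_apply, Pi.smul_apply, smul_eq_mul, Set.piecewise_eq_of_mem _ _ _ hx,
        huA x hx]
      linarith
    · simpa [hx] using hubound x
  have hle1 : A.piecewise v h ≤ A.piecewise v 1 := fun x => by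
    by_cases hx : x ∈ A
    · simp [hx]
    · simpa [hx] using (hh x).2
  intro x
  -- Since `T` fixes `u`, iterate `huseg`: the part carrying `h` off `A` stays below `v`, and the
  -- part carrying `1` tends to `u`. As `c < 1`, this yields `u ≤ v`.
  have hkey : u x ≤ (1 - c) * v x + c * u x := by
    refine ge_of_tendsto' (((hu x).const_mul c).const_add ((1 - c) * v x)) fun n => ?_
    have e1 : u x ≤ T^[n] u x := hT.le_iterate hum hTu.ge n x
    have e2 := (hT.iterate n).mono hum (segment_mem_unitCube hbh hb1 hcI) huseg x
    have e3 := (hT.iterate n).segment_le hbh hb1 hle1 hcI x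
    have e4 := mul_le_mul_of_nonneg_left (hlow n x) (sub_nonneg.2 hc.le)
    simp only [Pi.add_apply, Pi.smul_apply, smul_eq_mul] at e3
    linarith
  have : 0 < 1 - c := sub_pos.2 hc
  nlinarith

/-- An irreducible process with at most one child per individual that is not certain to become
extinct in `A` is singular. -/
lemma Irreducible.singular_of_forall_le_one {p : BlockLHBP d} (hp : p.Irreducible)
    {A : Set (TypeSet d)} (hAf : A.Finite) (hAne : A.Nonempty)
    (hv1 : ∀ x, p.extinction A x < 1)
    (hone : ∀ j, ∀ r ∈ (p.law j).support, (r.sum fun _ n => n) ≤ 1) : p.Singular := by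
  classical
  have hsingle : ∀ r : OffspringVec d, (r.sum fun _ n => n) ≤ 1 →
      r = 0 ∨ ∃ x, r = Finsupp.single x 1 := by
    intro r hr
    by_cases h0 : r = 0
    · exact Or.inl h0
    · obtain ⟨x, hx⟩ := Finsupp.ne_iff.1 h0
      obtain ⟨r', rfl⟩ := exists_eq_single_add hx
      rw [Finsupp.sum_add_index' (by simp) (by simp), Finsupp.sum_single_index rfl] at hr
      have : r' = 0 := by
        by_contra h0'
        obtain ⟨y, hy⟩ := Finsupp.ne_iff.1 h0'
        obtain ⟨r'', rfl⟩ := exists_eq_single_add hy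
        rw [Finsupp.sum_add_index' (by simp) (by simp), Finsupp.sum_single_index rfl] at hr
        omega
      exact Or.inr ⟨x, by rw [this, add_zero]⟩
  have hvm := p.extinction_mem A
  have hv := p.progenyGF_extinction A
  obtain ⟨j₁, hj₁, hmax⟩ := hAf.exists_maximalFor (p.extinction A) A hAne
  obtain ⟨j₀, hj₀, hmin⟩ := hAf.exists_minimalFor (p.extinction A) A hAne
  obtain ⟨u, hu, huv⟩ := p.exists_tendsto_frozen_extinction (A := A) (hvm j₁).1 (hv1 j₁)
    (fun x hx => (le_total _ _).elim id (fun h => hmax hx h))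
  set v := p.extinction A
  -- The minimum of `v` over `A`. With at most one child per individual the constant `c` is a
  -- subsolution; comparison through the frozen iterates gives `c ≤ v` everywhere, with equality at
  -- `j₀`.
  set c := v j₀
  have hmin' : ∀ x ∈ A, c ≤ v x := fun x hx => (le_total _ _).elim id (fun h => hmin hx h)
  let C : TypeSet d → ℝ := fun _ => c
  have hC : C ∈ unitCube d := fun _ => hvm j₀
  have hcm : ∀ r : OffspringVec d, (r.sum fun _ n => n) ≤ 1 → c ≤ monomial C r := by
    intro r hr
    rcases hsingle r hr with rfl | ⟨x, rfl⟩
    · simpa using (hvm j₀).2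
    · simp [C]
  have hmono : ∀ j, ∀ r, (p.law j r).toReal * c ≤ (p.law j r).toReal * monomial C r := by
    intro j r
    by_cases hr : r ∈ (p.law j).support
    · exact mul_le_mul_of_nonneg_left (hcm r (hone j r hr)) ENNReal.toReal_nonneg
    · rw [PMF.mem_support_iff, not_not] at hr
      simp [hr]
  have hsumc : ∀ j, HasSum (fun r => (p.law j r).toReal * c) c := fun j => by
    simpa using (p.hasSum_law j).mul_right c
  have hGC : C ≤ p.progenyGF C := fun j => by
    have := (hsumc j).summable.tsum_le_tsum (hmono j) (p.summable_progenyGF hC j)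
    rwa [(hsumc j).tsum_eq] at this
  have hcv : C ≤ v := by
    refine le_trans (fun x => ?_) huv
    refine ge_of_tendsto' (hu x) fun n => ?_
    have hT := p.isGenOp_frozen A
    have h1 : C ≤ frozen A p.progenyGF C := fun x => by
      by_cases hx : x ∈ A
      · simp [frozen, hx]
      · simpa [frozen, hx] using hGC x
    have hpm : A.piecewise v 1 ∈ unitCube d := fun x => by
      by_cases hx : x ∈ A
      · simpa [hx] using hvm x
      · simp [hx]
    refine (hT.le_iterate hC h1 n x).trans ((hT.iterate n).mono hC hpm (fun x => ?_) x)
    by_cases hx : x ∈ A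
    · simpa [hx] using hmin' x hx
    · simpa [hx] using (hvm j₀).2
  -- Contact of `v` with `c` rules out childlessness, since the empty monomial is `1 > c`, and
  -- passes to the only child.
  have hstep : ∀ j, v j = c → ∀ r ∈ (p.law j).support, ∃ x, r = Finsupp.single x 1 ∧ v x = c := by
    intro j hj r hr
    have hle : p.progenyGF v j ≤ c := by rw [hv, hj]
    have e1 := p.eq_on_support_of_tsum_eq (p.summable_progenyGF hC j) (p.summable_progenyGF hvm j)
      (monomial_mono hC hcv) (hle.trans (hGC j)) r hr
    have e2 : monomial C r = c := by
      by_contra hne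
      have hpos : 0 < (p.law j r).toReal :=
        ENNReal.toReal_pos ((p.law j).mem_support_iff r |>.1 hr) ((p.law j).apply_ne_top r)
      have hlt := Summable.tsum_lt_tsum (hmono j) (mul_lt_mul_of_pos_left
        (lt_of_le_of_ne (hcm r (hone j r hr)) (Ne.symm hne)) hpos) (hsumc j).summable
        (p.summable_progenyGF hC j)
      rw [(hsumc j).tsum_eq] at hlt
      exact (hlt.trans_le (p.progenyGF_mono hC hvm hcv j)).not_ge hle
    rcases hsingle r (hone j r hr) with rfl | ⟨x, rfl⟩
    · rw [monomial_zero] at e2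
      exact absurd e2.symm (hv1 j₀).ne
    · refine ⟨x, rfl, ?_⟩
      rw [← e2, e1]
      simp
  have hall := hp.forall_of_exists (P := fun j => v j = c) (fun j hj r hr x hx => by
    obtain ⟨y, rfl, hy⟩ := hstep j hj r hr
    have : y = x := by
      by_contra hne
      exact hx (Finsupp.single_eq_of_ne (Ne.symm hne))
    rwa [← this]) (rfl : v j₀ = c)
  intro j r hr
  obtain ⟨x, rfl, -⟩ := hstep j (hall j) r hr
  simp

/-- In an irreducible non-singular process, `p.extinction A` for a finite set `A` dominates all
subsolutions that are smaller than one. -/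
lemma Irreducible.le_extinction {p : BlockLHBP d} (hp : p.Irreducible) (hns : ¬ p.Singular)
    {A : Set (TypeSet d)} (hAf : A.Finite) (hAne : A.Nonempty) {s : TypeSet d → ℝ}
    (hs : s ∈ unitCube d) (hsub : s ≤ p.progenyGF s) (hs1 : ∀ x, s x < 1) :
    s ≤ p.extinction A := by
  classical
  have hvm := p.extinction_mem A
  have hv := p.progenyGF_extinction A
  by_cases hne : p.extinction A = 1
  · rw [hne]; exact fun x => (hs x).2
  have hv1 := hp.lt_one hvm hv hne
  have hT := p.isGenOp_frozen A
  obtain ⟨j₁, hj₁, hmax⟩ := hAf.exists_maximalFor (p.extinction A) A hAne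
  obtain ⟨u, hu, huv⟩ := p.exists_tendsto_frozen_extinction (A := A) (hvm j₁).1 (hv1 j₁)
    (fun x hx => (le_total _ _).elim id (fun h => hmax hx h))
  have hsingular := fun h => hns (hp.singular_of_forall_le_one hAf hAne hv1 h)
  set v := p.extinction A
  have hpw : ∀ {f}, f ∈ unitCube d → A.piecewise f 1 ∈ unitCube d := fun {f} hf x => by
    by_cases hx : x ∈ A
    · simpa [hx] using hf x
    · simp [hx]
  have hsT : ∀ n, s ≤ (frozen A p.progenyGF)^[n] (A.piecewise s 1) := fun n => by
    have h1 : s ≤ frozen A p.progenyGF s := fun x => by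
      by_cases hx : x ∈ A
      · simp [frozen, hx]
      · simpa [frozen, hx] using hsub x
    refine (hT.le_iterate hs h1 n).trans ((hT.iterate n).mono hs (hpw hs) fun x => ?_)
    by_cases hx : x ∈ A
    · simp [hx]
    · simpa [hx] using (hs x).2
  -- The quotient at `x` is the parameter at which the segment from `v x` to `1` reaches `s x`; its
  -- maximum is the least `t` for which `s` lies below the segment on `A`.
  obtain ⟨j₀, hj₀, hmaxt⟩ := hAf.exists_maximalFor (fun x => (s x - v x) / (1 - v x)) A hAne
  set t := (s j₀ - v j₀) / (1 - v j₀) with ht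
  have hvpos : ∀ x, 0 < 1 - v x := fun x => sub_pos.2 (hv1 x)
  have hmaxt' : ∀ x ∈ A, s x ≤ v x + t * (1 - v x) := fun x hx => by
    have : (s x - v x) / (1 - v x) ≤ t := (le_total _ _).elim id (fun h => hmaxt hx h)
    rw [div_le_iff₀ (hvpos x)] at this
    linarith
  have hj₀eq : s j₀ = v j₀ + t * (1 - v j₀) := by
    rw [ht, div_mul_cancel₀ _ (hvpos j₀).ne']; ring
  rcases le_or_gt t 0 with ht0 | ht0
  · intro x
    refine le_trans ?_ (huv x)
    refine ge_of_tendsto' (hu x) fun n => ?_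
    refine (hsT n x).trans ((hT.iterate n).mono (hpw hs) (hpw hvm) (fun x => ?_) x)
    by_cases hx : x ∈ A
    · simp only [Set.piecewise_eq_of_mem _ _ _ hx]
      nlinarith [hmaxt' x hx, hvpos x]
    · simp [hx]
  exfalso
  have ht1 : t < 1 := by
    rw [ht, div_lt_one (hvpos j₀)]
    linarith [hs1 j₀]
  have htI : t ∈ Set.Icc (0 : ℝ) 1 := ⟨ht0.le, ht1.le⟩
  set w : TypeSet d → ℝ := (1 - t) • v + t • 1 with hw
  have hwx : ∀ x, w x = (1 - t) * v x + t := fun x => by simp [hw]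
  have hwm : w ∈ unitCube d := segment_mem_unitCube hvm one_mem_unitCube htI
  have hwpos : ∀ x, 0 < w x := fun x => by
    rw [hwx]
    have := mul_nonneg (sub_nonneg.2 ht1.le) (hvm x).1
    linarith
  have hsw : s ≤ w := fun x => by
    have h1 : s x ≤ (1 - t) * u x + t := by
      refine ge_of_tendsto' (((hu x).const_mul (1 - t)).add_const t) fun n => ?_
      have hle : A.piecewise s 1 ≤ (1 - t) • A.piecewise v 1 + t • 1 := fun x => by
        by_cases hx : x ∈ A
        · have := hmaxt' x hx
          simp only [Pi.add_apply, Pi.smul_apply, smul_eq_mul, Set.piecewise_eq_of_mem _ _ _ hx,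
            Pi.one_apply]
          linarith
        · simp [hx]
      have := (hsT n x).trans (((hT.iterate n).mono (hpw hs) (segment_mem_unitCube (hpw hvm)
        one_mem_unitCube htI) hle x).trans ((hT.iterate n).segment_le (hpw hvm) one_mem_unitCube
        (fun x => (hpw hvm x).2) htI x))
      simpa [(hT.iterate n).one] using this
    rw [hwx]
    have := mul_le_mul_of_nonneg_left (huv x) (sub_nonneg.2 ht1.le)
    linarith
  have hsummable : ∀ j, HasSum (fun r => (p.law j r).toReal * ((1 - t) * monomial v r + t))
      (w j) := fun j => by
    have h1 := ((p.summable_progenyGF hvm j).hasSum.mul_left (1 - t)).add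
      ((p.hasSum_law j).mul_right t)
    rw [← progenyGF_eq, hv, one_mul, ← hwx] at h1
    exact h1.congr_fun (fun r => by ring)
  have hGw : ∀ r, monomial w r ≤ (1 - t) * monomial v r + t := fun r => by
    have := monomial_segment_le hvm one_mem_unitCube (fun x => (hvm x).2) htI r
    rwa [monomial_one, mul_one] at this
  have hGwle : p.progenyGF w ≤ w := fun j => by
    have := (p.summable_progenyGF hwm j).tsum_le_tsum (fun r => mul_le_mul_of_nonneg_left (hGw r)
      (ENNReal.toReal_nonneg (a := p.law j r))) (hsummable j).summable
    rwa [(hsummable j).tsum_eq] at this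
  -- A subsolution touches a supersolution from below; positivity of `w` passes the contact from
  -- monomials to each possible child.
  have hall := hp.forall_of_exists (P := fun j => s j = w j) (fun j hj r hr x hx => by
    refine eq_of_monomial_eq hs hsw hwpos ?_ hx
    refine p.eq_on_support_of_tsum_eq (p.summable_progenyGF hs j) (p.summable_progenyGF hwm j)
      (monomial_mono hs hsw) ?_ r hr
    exact (hGwle j).trans (hj.ge.trans (hsub j))) (show s j₀ = w j₀ by rw [hj₀eq, hwx]; ring)
  refine hsingular fun j r hr => ?_
  by_contra! hr1
  -- Now `w = s ≤ G s ≤ G w`, so convexity holds with equality on the support, which is impossible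
  -- for two or more children.
  refine (monomial_segment_one_lt hvm hv1 ht0 ht1 hr1).ne ?_
  refine p.eq_on_support_of_tsum_eq (p.summable_progenyGF hwm j) (hsummable j).summable hGw ?_ r hr
  rw [(hsummable j).tsum_eq]
  exact (hall j).ge.trans ((hsub j).trans (p.progenyGF_mono hs hwm hsw j))

end Maximality

/-! ### Fixed points with a prescribed coordinate between global and partial extinction. -/

section Intermediate

variable {d : ℕ} (p : BlockLHBP d)

lemma globalExtinction_le {s : TypeSet d → ℝ} (hs : s ∈ unitCube d) (h : p.progenyGF s ≤ s) :
    p.globalExtinction ≤ s := by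
  classical
  obtain ⟨f, hf, h1, h2⟩ := p.exists_tendsto_extinction Set.univ
  have hf0 : f ≤ s := fun x => by
    have : f x = 0 := by
      refine tendsto_nhds_unique (h1 x) ?_
      simp [frozen_iterate_apply _ _ _ (Set.mem_univ x)]
    rw [this]
    exact (hs x).1
  intro x
  refine le_of_tendsto' (h2 x) fun N => ?_
  exact ((p.isGenOp_progenyGF.iterate N).mono hf hs hf0 x).trans
    (p.isGenOp_progenyGF.iterate_le hs h N x)

/-- Boundary value `u` off `A` and iteration from `0` on `A` give a solution on `A` whose value at
`y` grows with `u`. It is at most `q y` for `u = 0` and at least the extinction probability in `A`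
for `u = 1`; convexity excludes a jump over `x`. -/
lemma exists_fixed_on (A : Set (TypeSet d)) (y : TypeSet d) {x : ℝ}
    (hx0 : p.globalExtinction y ≤ x) (hx1 : x ≤ p.extinction A y) :
    ∃ s ∈ unitCube d, s y = x ∧ ∀ z ∈ A, p.progenyGF s z = s z := by
  classical
  have hG := p.isGenOp_progenyGF
  have hT := p.isGenOp_frozen Aᶜ
  have hTA : ∀ f, ∀ z ∈ A, frozen Aᶜ p.progenyGF f z = p.progenyGF f z := fun f z hz => by
    simp [frozen, hz]
  have hTA' : ∀ f, ∀ z ∉ A, frozen Aᶜ p.progenyGF f z = f z := fun f z hz => by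
    simp [frozen, hz]
  have hTn : ∀ n f z, z ∉ A → (frozen Aᶜ p.progenyGF)^[n] f z = f z := fun n f z hz =>
    frozen_iterate_apply _ f n (A := Aᶜ) hz
  set T := frozen Aᶜ p.progenyGF
  let f : ℝ → TypeSet d → ℝ := fun u => A.piecewise 0 fun _ => u
  have hfA : ∀ u, ∀ z ∈ A, f u z = 0 := fun u z hz => by simp [f, hz]
  have hfA' : ∀ u, ∀ z ∉ A, f u z = u := fun u z hz => by simp [f, hz]
  have hfm : ∀ u ∈ Set.Icc (0 : ℝ) 1, f u ∈ unitCube d := fun u hu z => by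
    by_cases hz : z ∈ A
    · rw [hfA u z hz]; simp
    · rw [hfA' u z hz]; exact hu
  have h1I : (1 : ℝ) ∈ Set.Icc (0 : ℝ) 1 := by simp
  -- Bounding every iterate, not just the limit, makes `L` closed: each single iterate is continuous
  -- in `u`.
  let L : Set ℝ := {u | u ∈ Set.Icc (0 : ℝ) 1 ∧ ∀ n, T^[n] (f u) y ≤ x}
  have h0L : (0 : ℝ) ∈ L := by
    refine ⟨by simp, fun n => le_trans ?_ hx0⟩
    have hqm := p.extinction_mem Set.univ
    have hq := p.progenyGF_extinction Set.univ
    have hTq : T (p.extinction Set.univ) ≤ p.extinction Set.univ := fun z => by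
      by_cases hz : z ∈ A
      · rw [hTA _ z hz, hq]
      · rw [hTA' _ z hz]
    have hfq : f 0 ≤ p.extinction Set.univ := fun z => by
      by_cases hz : z ∈ A
      · rw [hfA 0 z hz]; exact (hqm z).1
      · rw [hfA' 0 z hz]; exact (hqm z).1
    exact ((hT.iterate n).mono (hfm 0 (by simp)) hqm hfq y).trans (hT.iterate_le hqm hTq n y)
  have hbdd : BddAbove L := ⟨1, fun u hu => hu.1.2⟩
  obtain ⟨us, -, hus, husL⟩ := exists_seq_tendsto_sSup ⟨0, h0L⟩ hbdd
  set a := sSup L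
  have haI : a ∈ Set.Icc (0 : ℝ) 1 :=
    isClosed_Icc.mem_of_tendsto hus (Eventually.of_forall fun n => (husL n).1)
  have haL : ∀ n, T^[n] (f a) y ≤ x := fun n => by
    refine le_of_tendsto' ((hT.iterate n).tendsto (F := fun k => f (us k)) (f := f a)
      (fun k => hfm _ (husL k).1) (fun z => ?_) y) fun k => (husL k).2 n
    by_cases hz : z ∈ A
    · simp only [hfA _ z hz]; exact tendsto_const_nhds
    · simpa only [hfA' _ z hz] using hus
  have hfT : f a ≤ T (f a) := fun z => by
    by_cases hz : z ∈ A
    · rw [hfA a z hz]; exact (hT.mem (hfm a haI) z).1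
    · rw [hTA' _ z hz]
  obtain ⟨g, hgm, hTg, hg, hleg⟩ := hT.exists_tendsto_of_ge (hfm a haI) hfT
  have hGg : ∀ z ∈ A, p.progenyGF g z = g z := fun z hz => by
    rw [← hTA g z hz, hTg]
  refine ⟨g, hgm, le_antisymm (le_of_tendsto' (hg y) haL) ?_, hGg⟩
  rcases haI.2.eq_or_lt with ha1 | ha1
  · refine hx1.trans ?_
    have hgA' : ∀ z ∉ A, g z = 1 := fun z hz => by
      refine tendsto_nhds_unique (hg z) ?_
      simp only [hTn _ _ z hz, hfA' _ z hz, ha1]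
      exact tendsto_const_nhds
    obtain ⟨h, hh, hh1, hh2⟩ := p.exists_tendsto_extinction A
    have hhg : h ≤ g := fun z => by
      by_cases hz : z ∈ A
      · have : h z = 0 := by
          refine tendsto_nhds_unique (hh1 z) ?_
          simp [frozen_iterate_apply _ _ _ hz, hz]
        rw [this]
        exact (hgm z).1
      · rw [hgA' z hz]; exact (hh z).2
    have hGle : p.progenyGF g ≤ g := fun z => by
      by_cases hz : z ∈ A
      · exact (hGg z hz).le
      · rw [hgA' z hz]; exact (hG.mem hgm z).2
    exact le_of_tendsto' (hh2 y) fun N =>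
      ((hG.iterate N).mono hh hgm hhg y).trans (hG.iterate_le hgm hGle N y)
  -- Moving the boundary value from `a` a fraction `ε` towards `1` leaves `L`, while convexity
  -- raises each iterate at `y` to at most `(1 - ε) g y + ε`.
  · have key : ∀ ε : ℝ, 0 < ε → ε < 1 → x ≤ g y + ε := by
      intro ε h0 h1
      have hεI : ε ∈ Set.Icc (0 : ℝ) 1 := ⟨h0.le, h1.le⟩
      have hlt : a < (1 - ε) * a + ε * 1 := by nlinarith
      have huI : (1 - ε) * a + ε * 1 ∈ Set.Icc (0 : ℝ) 1 :=
        convex_Icc (0 : ℝ) 1 haI h1I (sub_nonneg.2 h1.le) h0.le (by ring)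
      have hnot : (1 - ε) * a + ε * 1 ∉ L := fun h => (le_csSup hbdd h).not_gt hlt
      obtain ⟨n, hn⟩ : ∃ n, x < T^[n] (f ((1 - ε) * a + ε * 1)) y := by
        by_contra! h
        exact hnot ⟨huI, h⟩
      have hfeq : f ((1 - ε) * a + ε * 1) = (1 - ε) • f a + ε • f 1 := by
        ext z
        by_cases hz : z ∈ A <;> simp [f, hz]
      have hle : f a ≤ f 1 := fun z => by
        by_cases hz : z ∈ A
        · rw [hfA _ z hz, hfA _ z hz]
        · rw [hfA' _ z hz, hfA' _ z hz]; exact haI.2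
      have h3 := (hT.iterate n).segment_le (hfm a haI) (hfm 1 h1I) hle hεI y
      rw [← hfeq] at h3
      simp only [Pi.add_apply, Pi.smul_apply, smul_eq_mul] at h3
      have h4 := hleg n y
      have h5 := ((hT.iterate n).mem (hfm 1 h1I) y).2
      have h6 := (hgm y).1
      nlinarith [mul_le_mul_of_nonneg_left h4 (sub_nonneg.2 h1.le),
        mul_le_mul_of_nonneg_left h5 h0.le, mul_nonneg h0.le h6]
    by_contra! hlt
    have hx1' : x ≤ 1 := hx1.trans (p.extinction_mem A y).2
    have h6 := (hgm y).1
    have := key ((x - g y) / 2) (by linarith) (by linarith)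
    linarith

/-- Every value between the global and the partial extinction probability of a type is attained by
a fixed point of the progeny generating function. -/
lemma exists_fixedPoint_apply_eq (y : TypeSet d) {x : ℝ} (hx0 : p.globalExtinction y ≤ x)
    (hx1 : x ≤ p.partialExtinction y) : ∃ s ∈ p.fixedPoints, s y = x := by
  choose s hs hsy hfix using fun k => p.exists_fixed_on (lowLevels d k) y hx0
    (hx1.trans (p.partialExtinction_le k y))
  -- One ultrafilter makes all coordinates converge; the equation at `z` holds as soon as `k`
  -- reaches the level of `z`.
  have hlim : ∀ z, ∃ b ∈ Set.Icc (0 : ℝ) 1, Tendsto (s · z) (hyperfilter ℕ : Filter ℕ) (𝓝 b) :=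
    fun z => isCompact_Icc.ultrafilter_le_nhds ((hyperfilter ℕ).map (s · z))
      (by
        rw [Ultrafilter.coe_map, le_principal_iff]
        exact Filter.mem_map.2 (Eventually.of_forall fun k => hs k z))
  choose b hb hbt using hlim
  refine ⟨b, ⟨hb, ?_⟩, ?_⟩
  · ext z
    refine tendsto_nhds_unique (hbt z) ((p.progenyGF_tendsto hs hbt z).congr' ?_)
    have hev : ∀ᶠ k in atTop, p.progenyGF (s k) z = s k z := by
      filter_upwards [eventually_ge_atTop z.1] with k hk
      exact hfix k z hk
    exact Nat.hyperfilter_le_atTop hev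
  · refine tendsto_nhds_unique (hbt y) ?_
    simp only [hsy]
    exact tendsto_const_nhds

end Intermediate

/-! ### Transfer between the block process and the single-phase process. -/

section LocalIsomorphism

variable {d : ℕ}

/-- The vector that is constant on levels with the given values. -/
def lift (d : ℕ) (f : TypeSet 1 → ℝ) : TypeSet d → ℝ := fun x => f (x.1, 0)

/-- The numbers of children in each level. -/
noncomputable def levelSums (r : OffspringVec d) : OffspringVec 1 :=
  r.mapDomain fun x => (x.1, 0)

lemma lift_mem {f : TypeSet 1 → ℝ} (hf : f ∈ unitCube 1) : lift d f ∈ unitCube d := fun _ => hf _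

lemma monomial_lift (f : TypeSet 1 → ℝ) (r : OffspringVec d) :
    monomial (lift d f) r = monomial f (levelSums r) :=
  (Finsupp.prod_mapDomain_index (h := fun x n => f x ^ n) (fun _ => pow_zero _)
    fun _ _ _ => pow_add _ _ _).symm

lemma levelSums_apply (r : OffspringVec d) (l : ℕ) :
    levelSums r (l, 0) = ∑ a : Fin d, r (l, a) := by
  classical
  induction r using offspring_induction with
  | h0 => simp [levelSums]
  | h1 x r ih =>
    rw [levelSums] at ih ⊢
    rw [Finsupp.mapDomain_add, Finsupp.add_apply, ih, Finsupp.mapDomain_single]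
    simp only [Finsupp.add_apply, Finset.sum_add_distrib, add_left_inj]
    obtain ⟨k, i⟩ := x
    simp only [Finsupp.single_apply, Prod.mk.injEq, and_true]
    by_cases hk : k = l <;> simp [hk]

lemma levelSums_eq_iff (r : OffspringVec d) (u : OffspringVec 1) :
    levelSums r = u ↔ ∀ l : ℕ, ∑ a : Fin d, r (l, a) = u (l, 0) := by
  constructor
  · rintro rfl l
    exact (levelSums_apply r l).symm
  · intro h
    ext ⟨l, i⟩
    rw [Subsingleton.elim i 0, levelSums_apply, h]

lemma levelSums_sum (r : OffspringVec d) :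
    ((levelSums r).sum fun _ n => n) = r.sum fun _ n => n :=
  Finsupp.sum_mapDomain_index (by simp) (by simp)

variable {p : BlockLHBP d} {phat : BlockLHBP 1}

/-- A monomial in a vector constant on levels depends only on the level sums, so the series can be
grouped along the fibres of `levelSums`. Extended nonnegative reals make the regrouping
unconditional. -/
lemma LocallyIsomorphic.progenyGF_lift (hiso : p.LocallyIsomorphic phat) {f : TypeSet 1 → ℝ}
    (hf : f ∈ unitCube 1) : p.progenyGF (lift d f) = lift d (phat.progenyGF f) := by
  have hENN : ∀ {e : ℕ} (P : BlockLHBP e) {g : TypeSet e → ℝ} (_ : g ∈ unitCube e) (j : TypeSet e),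
      P.progenyGF g j = (∑' r, P.law j r * ENNReal.ofReal (monomial g r)).toReal := by
    intro e P g hg j
    rw [ENNReal.tsum_toReal_eq fun r =>
      ENNReal.mul_ne_top ((P.law j).apply_ne_top r) ENNReal.ofReal_ne_top]
    refine tsum_congr fun r => ?_
    rw [ENNReal.toReal_mul, ENNReal.toReal_ofReal (monomial_mem hg r).1]
    rfl
  ext ⟨k, i⟩
  rw [hENN p (lift_mem hf), lift, hENN phat hf]
  congr 1
  rw [← (Equiv.sigmaFiberEquiv (levelSums (d := d))).tsum_eq, ENNReal.tsum_sigma']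
  refine tsum_congr fun u => ?_
  rw [hiso k i u, ← ENNReal.tsum_mul_right]
  refine ((Equiv.tsum_eq (Equiv.subtypeEquivRight fun r => levelSums_eq_iff r u) _).symm.trans
    ?_).symm
  refine tsum_congr fun r => ?_
  simp only [Equiv.sigmaFiberEquiv, Equiv.coe_fn_mk, monomial_lift, r.2]
  rfl

-- For a union of levels, freezing also commutes with `lift`, hence so do all iterates and limits
-- that define the extinction probability.
open Classical in
lemma LocallyIsomorphic.extinction_lift (hiso : p.LocallyIsomorphic phat) {A : Set (TypeSet d)}
    {B : Set (TypeSet 1)} (hAB : ∀ x, x ∈ A ↔ (x.1, 0) ∈ B) :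
    p.extinction A = lift d (phat.extinction B) := by
  obtain ⟨h, hh, h1, h2⟩ := p.exists_tendsto_extinction A
  obtain ⟨h', hh', h1', h2'⟩ := phat.exists_tendsto_extinction B
  have hBm : B.piecewise (0 : TypeSet 1 → ℝ) 1 ∈ unitCube 1 := fun x => by
    by_cases hx : x ∈ B <;> simp [hx]
  have hfrozen : ∀ m, (frozen A p.progenyGF)^[m] (A.piecewise 0 1) =
      lift d ((frozen B phat.progenyGF)^[m] (B.piecewise 0 1)) := fun m => by
    induction m with
    | zero =>
      ext x
      simp only [Function.iterate_zero, id_eq, lift, Set.piecewise, hAB]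
      rfl
    | succ m ih =>
      rw [Function.iterate_succ_apply', Function.iterate_succ_apply', ih, frozen,
        hiso.progenyGF_lift (((phat.isGenOp_frozen B).iterate m).mem hBm)]
      ext x
      simp only [frozen, lift, Set.piecewise, hAB]
  have hlift : h = lift d h' := by
    ext x
    refine tendsto_nhds_unique (h1 x) ?_
    simp only [hfrozen]
    exact h1' _
  have hiter : ∀ N, p.progenyGF^[N] h = lift d (phat.progenyGF^[N] h') := fun N => by
    induction N with
    | zero => exact hlift
    | succ N ih =>
      rw [Function.iterate_succ_apply', Function.iterate_succ_apply', ih,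
        hiso.progenyGF_lift ((phat.isGenOp_progenyGF.iterate N).mem hh')]
  ext x
  refine tendsto_nhds_unique (h2 x) ?_
  simp only [hiter]
  exact h2' _

lemma LocallyIsomorphic.globalExtinction_lift (hiso : p.LocallyIsomorphic phat) :
    p.globalExtinction = lift d phat.globalExtinction :=
  hiso.extinction_lift fun x => by simp

lemma LocallyIsomorphic.partialExtinction_lift (hiso : p.LocallyIsomorphic phat) :
    p.partialExtinction = lift d phat.partialExtinction := by
  ext x
  refine tendsto_nhds_unique (p.tendsto_partialExtinction x) ?_
  simp only [fun k => hiso.extinction_lift (A := lowLevels d k) (B := lowLevels 1 k)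
    fun x => Iff.rfl]
  exact phat.tendsto_partialExtinction _

lemma LocallyIsomorphic.singular [NeZero d] (hiso : p.LocallyIsomorphic phat) (h : p.Singular) :
    phat.Singular := by
  rintro ⟨k, i⟩ u hu
  rw [Subsingleton.elim i 0, PMF.mem_support_iff, hiso k 0 u, ne_eq, ENNReal.tsum_eq_zero,
    not_forall] at hu
  obtain ⟨⟨r, hr⟩, hne⟩ := hu
  rw [← levelSums_eq_iff] at hr
  rw [← hr, levelSums_sum]
  exact h (k, 0) r ((PMF.mem_support_iff _ _).2 hne)

lemma LocallyIsomorphic.exists_fixedPoint_lift (hiso : p.LocallyIsomorphic phat) (k : ℕ)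
    {x : ℝ} (hx0 : phat.globalExtinction (k, 0) ≤ x) (hx1 : x ≤ phat.partialExtinction (k, 0)) :
    ∃ s ∈ p.fixedPoints, ∀ i, s (k, i) = x := by
  obtain ⟨s, ⟨hs, hfix⟩, hsx⟩ := phat.exists_fixedPoint_apply_eq (k, 0) hx0 hx1
  exact ⟨lift d s, ⟨lift_mem hs, by rw [hiso.progenyGF_lift hs, ← hfix]⟩, fun _ => hsx⟩

end LocalIsomorphism

/-! ### Extremal elements of the fixed point set. -/

section FixedPoints

variable {d : ℕ} (p : BlockLHBP d)

lemma globalExtinction_mem_fixedPoints : p.globalExtinction ∈ p.fixedPoints :=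
  ⟨p.extinction_mem _, (p.progenyGF_extinction _).symm⟩

lemma partialExtinction_mem_fixedPoints : p.partialExtinction ∈ p.fixedPoints :=
  ⟨p.partialExtinction_mem, p.progenyGF_partialExtinction.symm⟩

lemma isLeast_globalExtinction : IsLeast p.fixedPoints p.globalExtinction :=
  ⟨p.globalExtinction_mem_fixedPoints, fun _ hs => p.globalExtinction_le hs.1 hs.2.ge⟩

lemma finite_lowLevels (k : ℕ) : (lowLevels d k).Finite :=
  ((Set.finite_Iic k).prod (Set.finite_univ (α := Fin d))).subset fun _ hx => ⟨hx, Set.mem_univ _⟩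

lemma Irreducible.le_partialExtinction [NeZero d] {p : BlockLHBP d} (hp : p.Irreducible)
    (hns : ¬ p.Singular) {s : TypeSet d → ℝ} (hs : s ∈ p.fixedPoints) (hne : s ≠ 1) :
    s ≤ p.partialExtinction := fun x =>
  ge_of_tendsto' (p.tendsto_partialExtinction x) fun k =>
    hp.le_extinction hns (finite_lowLevels k) ⟨(0, 0), Nat.zero_le k⟩ hs.1 hs.2.le
      (hp.lt_one hs.1 hs.2.symm hne) x

/-- Here `1` itself is excluded from the set, so it must be approached: a fixed point other than `1`
forces `q < 1` everywhere, and every value in `(q, 1)` is attained at the given level by a fixed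
point. -/
lemma Irreducible.isLUB_one [NeZero d] {p : BlockLHBP d} {phat : BlockLHBP 1}
    (hp : p.Irreducible) (hiso : p.LocallyIsomorphic phat) (h1 : p.partialExtinction = 1)
    (hne : (p.fixedPoints \ {1}).Nonempty) : IsLUB (p.fixedPoints \ {1}) 1 := by
  refine ⟨fun s hs x => (hs.1.1 x).2, fun b hb => ?_⟩
  obtain ⟨s₀, hs₀, hs₀1⟩ := hne
  have hs₀lt := hp.lt_one hs₀.1 hs₀.2.symm hs₀1
  have hq : ∀ x, p.globalExtinction x < 1 := fun x =>
    (p.isLeast_globalExtinction.2 hs₀ x).trans_lt (hs₀lt x)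
  rintro ⟨k, i⟩
  refine le_of_forall_lt fun c hc => ?_
  have hqk := congrFun hiso.globalExtinction_lift (k, i)
  have hpk := congrFun hiso.partialExtinction_lift (k, i)
  simp only [lift] at hqk hpk
  obtain ⟨x, hcx, hx1⟩ := exists_between (max_lt hc (hq (k, i)))
  obtain ⟨s, hs, hsx⟩ := hiso.exists_fixedPoint_lift k (x := x)
    (hqk ▸ ((le_max_right _ _).trans hcx.le)) (by rw [← hpk, h1]; exact hx1.le)
  have hsne : s ≠ 1 := fun h => by
    have := hsx i
    rw [h] at this
    exact hx1.ne this.symm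
  have := hb ⟨hs, hsne⟩ (k, i)
  rw [hsx i] at this
  exact ((le_max_left _ _).trans_lt hcx).trans_le this

end FixedPoints

end BlockLHBP

theorem mainTheorem9 {d : ℕ} [NeZero d] (p : BlockLHBP d) (phat : BlockLHBP 1)
    (hiso : p.LocallyIsomorphic phat) (hirr : phat.Irreducible) :
    IsLeast p.fixedPoints p.globalExtinction ∧
    (p.Irreducible → (¬ phat.Singular ∨ p.partialExtinction = 1) →
      (p.fixedPoints \ {1}).Nonempty →
      IsLUB (p.fixedPoints \ {1}) p.partialExtinction) ∧
    (∀ (k : ℕ) (i : Fin d), p.globalExtinction (k, i) = p.globalExtinction (k, 0)) ∧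
    (∀ (k : ℕ) (i : Fin d), p.partialExtinction (k, i) = p.partialExtinction (k, 0)) ∧
    (∀ (k : ℕ), ∀ x ∈ Set.Icc (0 : ℝ) 1,
      (fun _ : Fin d => x * p.globalExtinction (k, 0) + (1 - x) * p.partialExtinction (k, 0))
        ∈ p.levelProjection k) := by
  have hq := hiso.globalExtinction_lift
  have hqt := hiso.partialExtinction_lift
  refine ⟨p.isLeast_globalExtinction, fun hp hor hne => ?_, fun k i => by rw [hq]; rfl,
    fun k i => by rw [hqt]; rfl, fun k x hx => ?_⟩
  · by_cases h1 : p.partialExtinction = 1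
    · rw [h1]
      exact hp.isLUB_one hiso h1 hne
    · have hns := hor.resolve_right h1
      -- In this case `q̃` belongs to the set, so the supremum is a maximum.
      exact ⟨fun s hs => hp.le_partialExtinction (fun h => hns (hiso.singular h)) hs.1 hs.2,
        fun b hb => hb ⟨p.partialExtinction_mem_fixedPoints, h1⟩⟩
  · have h0 : p.globalExtinction (k, 0) = phat.globalExtinction (k, 0) := congrFun hq (k, 0)
    have h1 : p.partialExtinction (k, 0) = phat.partialExtinction (k, 0) := congrFun hqt (k, 0)
    have hle := p.globalExtinction_le_partialExtinction (k, 0)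
    obtain ⟨s, hs, hsx⟩ := hiso.exists_fixedPoint_lift k
      (x := x * p.globalExtinction (k, 0) + (1 - x) * p.partialExtinction (k, 0))
      (by rw [← h0]; nlinarith [mul_le_mul_of_nonneg_left hle (sub_nonneg.2 hx.2)])
      (by rw [← h1]; nlinarith [mul_le_mul_of_nonneg_left hle hx.1])
    exact ⟨fun i => hsx i ▸ hs.1 (k, i), s, hs, hsx⟩
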